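/- **Theorem (Autocorrelation of dense Dirac combs).** Let $\widetilde L\subset\mathbb R^d\times\mathbb R^m$ be a lattice, let $|\det(\widetilde L)|$ be the volume of a fundamental domain of it, and let $\pi_1,\pi_2$ be the projections of $\mathbb R^d\times\mathbb R^m$ onto $\mathbb R^d$ and $\mathbb R^m$. Assume that $\pi_1|_{\widetilde L}$ and $\pi_2|_{\widetilde L}$ are both one-to-one and that $\pi_1(\widetilde L)$ and $\pi_2(\widetilde L)$ are dense in $\mathbb R^d$ and $\mathbb R^m$, respectively. Put $L=\pi_1(\widetilde L)$ and, for $x\in L$, let $x^\star=\pi_2\big((\pi_1|_{\widetilde L})^{-1}(x)\big)$. Let $f:\mathbb R^m\to\mathbb C$ be continuous with $|x|^{m+1+\alpha}|f(x)|\le C$ for all $x\in\mathbb R^m$, for some constants $C>0$ and $\alpha>0$. Then the weighted Dirac comb $\omega=\sum_{x\in L}f(x^\star)\,\delta_x$ is a well-defined complex measure on $\mathbb R^d$ (the weights are absolutely summable over bounded sets). For $r>0$ let $B_r\subset\mathbb R^d$ be the closed ball of radius $r$ centred at $0$, let $\omega_r=\omega|_{B_r}$, let $\widetilde{\omega_r}$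 be the measure $A\mapsto\overline{\omega_r(-A)}$, and let $\gamma_\omega^{(r)}=\frac1{\mathrm{vol}(B_r)}\,\omega_r*\widetilde{\omega_r}$ be the finite autocorrelation measures. As $r\to\infty$, the measures $\gamma^{(r)}_\omega$ converge vaguely, i.e. when integrated against every continuous compactly supported function $\mathbb R^d\to\mathbb C$, and the limit is the unique measure $$\gamma_\omega=\sum_{z\in L}\eta(z)\,\delta_z,\qquad \eta(z)=\frac1{|\det(\widetilde L)|}\int_{\mathbb R^m}f(u)\,\overline{f(u-z^\star)}\,du ,$$ where the integrals defining $\eta(z)$ converge absolutely and the $\eta(z)$ are absolutely summable over bounded sets. The measure $\gamma_\omega$ is * translation bounded: for every compact $K\subset\mathbb R^d$, $\sup_{y\in\mathbb R^d}|\gamma_\omega|(y+K)<\infty$, where $|\gamma_\omega|$ is the total variation measure; * positive definite: $\gamma_\omega(g*\widetilde g)\ge 0$ for every continuous compactly supported $g:\mathbb R^d\to\mathbb C$, where $\widetilde g(x)=\overline{g(-x)}$; * pure point: $\gamma_\omega(A)=\sum_{x\in A}\gamma_\omega(\{x\})$ for every bounded Borel set $A$. -/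

import Mathlib

open MeasureTheory Set Filter Topology Bornology

noncomputable section

namespace DenseComb

theorem hasSum_indicator_inter_iUnion {E M : Type*} [AddCommMonoid M] [TopologicalSpace M]
    (S : Set E) (c : E → M) {A : ℕ → Set E} (hd : Pairwise (Function.onFun Disjoint A)) (x : E) :
    HasSum (fun i => (S ∩ A i).indicator c x) ((S ∩ ⋃ i, A i).indicator c x) := by
  by_cases hx : x ∈ S ∩ ⋃ i, A i
  · obtain ⟨i, hi⟩ := mem_iUnion.1 hx.2
    have hxi : x ∈ S ∩ A i := mem_inter hx.1 hi
    rw [indicator_of_mem hx, ← indicator_of_mem hxi c]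
    exact hasSum_single i fun j hj =>
      indicator_of_notMem (fun h => disjoint_left.1 (hd hj) h.2 hi) _
  · rw [indicator_of_notMem hx]
    have h0 : (fun i => (S ∩ A i).indicator c x) = fun _ => 0 := by
      funext i
      exact indicator_of_notMem (fun h => hx (mem_inter h.1 (mem_iUnion.2 ⟨i, h.2⟩))) _
    rw [h0]
    exact hasSum_zero

section LocalMeasures

variable {E : Type*} [NormedAddCommGroup E] [MeasurableSpace E]

/-- A complex (in general not finite) Borel measure on `E` that is finite on bounded sets: a
countably additive complex function on the bounded Borel sets. The value on all other sets is `0`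
by convention, so that two such measures are equal iff they agree on bounded Borel sets. -/
@[ext]
structure LocalComplexMeasure (E : Type*) [NormedAddCommGroup E] [MeasurableSpace E] where
  measureOf : Set E → ℂ
  eq_zero_of_not : ∀ A, ¬ (MeasurableSet A ∧ IsBounded A) → measureOf A = 0
  hasSum_iUnion : ∀ A : ℕ → Set E, (∀ i, MeasurableSet (A i)) → IsBounded (⋃ i, A i) →
    Pairwise (Function.onFun Disjoint A) →
    HasSum (fun i => measureOf (A i)) (measureOf (⋃ i, A i))

namespace LocalComplexMeasure

theorem measureOf_empty (μ : LocalComplexMeasure E) : μ.measureOf ∅ = 0 := by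
  have h := μ.hasSum_iUnion (fun _ => ∅) (fun _ => MeasurableSet.empty) (by simp)
    (fun i j _ => by simp [Function.onFun])
  simpa using h.summable.tendsto_atTop_zero

open Classical in
/-- The restriction of `μ` to a bounded Borel set `B`, a finite complex measure
(`0` by convention if `B` is not a bounded Borel set). -/
def restrict (μ : LocalComplexMeasure E) (B : Set E) : ComplexMeasure E :=
  if hB : MeasurableSet B ∧ IsBounded B then
    { measureOf' := fun A => if MeasurableSet A then μ.measureOf (A ∩ B) else 0
      empty' := by simp [μ.measureOf_empty]
      not_measurable' := fun A hA => if_neg hA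
      m_iUnion' := by
        intro A hA hd
        rw [if_pos (MeasurableSet.iUnion hA), iUnion_inter]
        simp only [hA, if_true]
        exact μ.hasSum_iUnion _ (fun i => (hA i).inter hB.1)
          (hB.2.subset (iUnion_subset fun i => inter_subset_right))
          (fun i j hij => (hd hij).mono inter_subset_left inter_subset_left) }
  else 0

/-- `μ(g) = ∫ g dμ` for a function `g` with compact support. -/
def integral (μ : LocalComplexMeasure E) (g : E → ℂ) : ℂ :=
  ∫ᵛ x, g x ∂[ContinuousLinearMap.mul ℝ ℂ; μ.restrict (tsupport g)]

/-- `|μ|(A)`, the total variation measure of `μ` evaluated at a bounded Borel set `A`. -/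
def variation (μ : LocalComplexMeasure E) (A : Set E) : ENNReal :=
  (μ.restrict A).variation A

/-- For every compact `K`, `|μ|(y + K)` is bounded uniformly in `y`. -/
def TranslationBounded (μ : LocalComplexMeasure E) : Prop :=
  ∀ K : Set E, IsCompact K → ∃ C : NNReal, ∀ y : E, μ.variation ((fun x => y + x) '' K) ≤ C

/-- The measure of every bounded Borel set is the sum of the masses of its points. -/
def PurePoint (μ : LocalComplexMeasure E) : Prop :=
  ∀ A : Set E, MeasurableSet A → IsBounded A →
    HasSum (fun x : A => μ.measureOf {(x : E)}) (μ.measureOf A)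

end LocalComplexMeasure

/-- The function `x ↦ conj (g (-x))`. -/
def tildeFun (g : E → ℂ) : E → ℂ := fun x => starRingEnd ℂ (g (-x))

/-- `μ(g ∗ g̃)` is real and nonnegative for all compactly supported continuous `g`. -/
def LocalComplexMeasure.PositiveDefinite {d : ℕ}
    (μ : LocalComplexMeasure (EuclideanSpace ℝ (Fin d))) : Prop :=
  ∀ g : EuclideanSpace ℝ (Fin d) → ℂ, Continuous g → HasCompactSupport g →
    0 ≤ (μ.integral (convolution g (tildeFun g) (ContinuousLinearMap.mul ℝ ℂ) volume)).re ∧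
    (μ.integral (convolution g (tildeFun g) (ContinuousLinearMap.mul ℝ ℂ) volume)).im = 0

/-- The family of weights `c x`, `x ∈ S`, is summable over every bounded set. -/
def LocallySummable (S : Set E) (c : E → ℂ) : Prop :=
  ∀ B : Set E, IsBounded B → Summable ((S ∩ B).indicator c)

open Classical in
/-- The weighted Dirac comb `∑_{x ∈ S} c x δ_x`, for locally summable weights
(`0` by convention if the weights are not locally summable). -/
def diracComb (S : Set E) (c : E → ℂ) : LocalComplexMeasure E where
  measureOf A := if LocallySummable S c ∧ MeasurableSet A ∧ IsBounded A then
    ∑' x, (S ∩ A).indicator c x else 0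
  eq_zero_of_not A hA := if_neg fun h => hA h.2
  hasSum_iUnion A hA hb hd := by
    by_cases hS : LocallySummable S c
    · have hbi : ∀ i, IsBounded (A i) := fun i => hb.subset (subset_iUnion A i)
      simp only [hS, hA, hbi, hb, MeasurableSet.iUnion hA, and_self, if_true]
      have hs : Summable ((S ∩ ⋃ i, A i).indicator c) := hS _ hb
      have key := hasSum_indicator_inter_iUnion S c hd
      have keyn : ∀ x, HasSum (fun i => ‖(S ∩ A i).indicator c x‖)
          ‖(S ∩ ⋃ i, A i).indicator c x‖ := by
        simpa only [norm_indicator_eq_indicator_norm]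
          using hasSum_indicator_inter_iUnion S (fun x => ‖c x‖) hd
      have hp : Summable (fun p : E × ℕ => (S ∩ A p.2).indicator c p.1) := by
        refine Summable.of_norm ?_
        rw [summable_prod_of_nonneg (fun _ => norm_nonneg _)]
        refine ⟨fun x => (keyn x).summable, ?_⟩
        simp only [(keyn _).tsum_eq]
        exact hs.norm
      have h2 : HasSum (fun p : ℕ × E => (S ∩ A p.1).indicator c p.2)
          (∑' x, (S ∩ ⋃ i, A i).indicator c x) := by
        rw [← (Equiv.prodComm E ℕ).hasSum_iff]
        rw [(hp.hasSum.prod_fiberwise key).tsum_eq]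
        exact hp.hasSum
      exact h2.prod_fiberwise fun i => (hS _ (hbi i)).hasSum
    · simp [hS]

end LocalMeasures

section Autocorrelation

variable {d : ℕ}

/-- The complex measure `ν̃` with `ν̃(g) = conj (ν(g̃))`, that is, `ν̃(A) = conj (ν(-A))`. -/
def tildeMeasure (ν : ComplexMeasure (EuclideanSpace ℝ (Fin d))) :
    ComplexMeasure (EuclideanSpace ℝ (Fin d)) :=
  (ν.map fun x => -x).mapRange (starRingEnd ℂ : ℂ →+* ℂ).toAddMonoidHom Complex.continuous_conj

/-- The convolution of finite complex measures: the image of the product measure under addition. -/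
def convMeasure (μ ν : ComplexMeasure (EuclideanSpace ℝ (Fin d))) :
    ComplexMeasure (EuclideanSpace ℝ (Fin d)) :=
  (μ.prod ν (ContinuousLinearMap.mul ℝ ℂ)).map fun p => p.1 + p.2

/-- The finite autocorrelation `vol(B_r)⁻¹ ω_r ∗ (ω_r)~`, where `ω_r` is the restriction of `ω` to
the closed ball `B_r` of radius `r` centred at the origin. -/
def finiteAutocorrelation (ω : LocalComplexMeasure (EuclideanSpace ℝ (Fin d))) (r : ℝ) :
    ComplexMeasure (EuclideanSpace ℝ (Fin d)) :=
  (((volume.real (Metric.closedBall (0 : EuclideanSpace ℝ (Fin d)) r))⁻¹ : ℝ) : ℂ) •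
    convMeasure (ω.restrict (Metric.closedBall 0 r)) (tildeMeasure (ω.restrict (Metric.closedBall 0 r)))

/-- `γ` is the vague limit of the finite autocorrelations of `ω` as the radius tends to
infinity. -/
def IsAutocorrelation (ω γ : LocalComplexMeasure (EuclideanSpace ℝ (Fin d))) : Prop :=
  ∀ g : EuclideanSpace ℝ (Fin d) → ℂ, Continuous g → HasCompactSupport g →
    Tendsto (fun r : ℝ => ∫ᵛ x, g x ∂[ContinuousLinearMap.mul ℝ ℂ; finiteAutocorrelation ω r])
      atTop (𝓝 (γ.integral g))

end Autocorrelation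

section CutAndProject

variable {d m : ℕ}

/-- The conditions on a lattice in `ℝ^d × ℝ^m` under which both projections are one-to-one on the
lattice and have dense image. -/
structure IsDenseCutAndProject
    (Λ : Submodule ℤ (EuclideanSpace ℝ (Fin d) × EuclideanSpace ℝ (Fin m))) : Prop where
  injOn_fst : InjOn Prod.fst (Λ : Set (EuclideanSpace ℝ (Fin d) × EuclideanSpace ℝ (Fin m)))
  injOn_snd : InjOn Prod.snd (Λ : Set (EuclideanSpace ℝ (Fin d) × EuclideanSpace ℝ (Fin m)))
  dense_fst : Dense (Prod.fst '' (Λ : Set (EuclideanSpace ℝ (Fin d) × EuclideanSpace ℝ (Fin m))))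
  dense_snd : Dense (Prod.snd '' (Λ : Set (EuclideanSpace ℝ (Fin d) × EuclideanSpace ℝ (Fin m))))

/-- The projection `L` of the lattice to direct space. -/
def directModule (Λ : Submodule ℤ (EuclideanSpace ℝ (Fin d) × EuclideanSpace ℝ (Fin m))) :
    Set (EuclideanSpace ℝ (Fin d)) :=
  Prod.fst '' (Λ : Set (EuclideanSpace ℝ (Fin d) × EuclideanSpace ℝ (Fin m)))

/-- The star map `π₂ ∘ (π₁|_Λ)⁻¹`; only its values on `directModule Λ` are meaningful. -/
def starMap (Λ : Submodule ℤ (EuclideanSpace ℝ (Fin d) × EuclideanSpace ℝ (Fin m)))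
    (x : EuclideanSpace ℝ (Fin d)) : EuclideanSpace ℝ (Fin m) :=
  (Function.invFunOn Prod.fst
    (Λ : Set (EuclideanSpace ℝ (Fin d) × EuclideanSpace ℝ (Fin m))) x).2

/-- The dense weighted Dirac comb `ω = ∑_{x ∈ L} f(x⋆) δ_x`. -/
def denseComb (Λ : Submodule ℤ (EuclideanSpace ℝ (Fin d) × EuclideanSpace ℝ (Fin m)))
    (f : EuclideanSpace ℝ (Fin m) → ℂ) : LocalComplexMeasure (EuclideanSpace ℝ (Fin d)) :=
  diracComb (directModule Λ) fun x => f (starMap Λ x)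

/-- The autocorrelation coefficient `η(z) = |det Λ|⁻¹ ∫ f(u) conj (f(u - z⋆)) du`. -/
def autocorrCoeff (Λ : Submodule ℤ (EuclideanSpace ℝ (Fin d) × EuclideanSpace ℝ (Fin m)))
    (f : EuclideanSpace ℝ (Fin m) → ℂ) (z : EuclideanSpace ℝ (Fin d)) : ℂ :=
  ((ZLattice.covolume Λ volume : ℝ) : ℂ)⁻¹ * ∫ u, f u * starRingEnd ℂ (f (u - starMap Λ z))

end CutAndProject

end DenseComb

end

/-!
The decay of `f` puts it in a Wiener amalgam space: its suprema over balls of a fixed radius are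
integrable. Comparing points with translated fundamental domains, the sum of `|f|` over the lattice
points above a set `A` is then at most a constant times the volume of a thickening of `A`.

Sums of such an `f` over the lattice points above `B_r` therefore obey a mean-value law. Translating
the lattice by a vector close to a lattice vector changes them by `o(vol B_r)`, because of the
volume bound, and the average over a fundamental domain of translates is exact; density of the
internal projection gives the limit `|det Λ|⁻¹ ∫ f`.

Sorting the pairs `(x, y)` in the finite autocorrelation by their difference `z = x - y`, the
coefficient of `z` is, up to a boundary term, such a mean of `u ↦ f(u) conj(f(u - z⋆))`, hence tends
to `η(z)`. It is dominated by a multiple of a convolution of the local suprema of `f`, again in the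
amalgam space, so the limit may be taken under the sum over `z`. Positive definiteness is inherited
from the finite autocorrelations, for which it is a square.
-/

noncomputable section

namespace DenseComb

section AtomicMeasures

variable {X Y ι κ : Type*} [MeasurableSpace X] [MeasurableSpace Y]

instance isFiniteMeasure_variation (ν : ComplexMeasure X) : IsFiniteMeasure ν.variation := by
  refine isFiniteMeasure_of_le
    ((ComplexMeasure.re ν).totalVariation + (ComplexMeasure.im ν).totalVariation)
    (VectorMeasure.variation_le_of_forall_enorm_le fun A _ => ?_)
  calc ‖ν A‖ₑ ≤ ‖(ν A).re‖ₑ + ‖(ν A).im‖ₑ := by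
        simp only [← ofReal_norm, ← ENNReal.ofReal_add, norm_nonneg]
        exact ENNReal.ofReal_le_ofReal (Complex.norm_le_abs_re_add_abs_im _)
    _ ≤ _ := add_le_add (SignedMeasure.enorm_le_totalVariation (ComplexMeasure.re ν) A)
        (SignedMeasure.enorm_le_totalVariation (ComplexMeasure.im ν) A)

/-- `ν = ∑ᵢ cᵢ δ_{pᵢ}` is a sum of point masses with summable weights. The points `pᵢ` may
coincide. -/
structure IsAtomic (ν : ComplexMeasure X) (p : ι → X) (c : ι → ℂ) : Prop where
  summable : Summable c
  hasSum : ∀ A, MeasurableSet A → HasSum ((p ⁻¹' A).indicator c) (ν A)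

theorem isAtomic_sum_dirac (p : ι → X) (c : ι → ℂ) (s : Finset ι) :
    IsAtomic (∑ i ∈ s, VectorMeasure.dirac (p i) (c i)) p ((s : Set ι).indicator c) := by
  classical
  refine ⟨summable_of_hasFiniteSupport (s.finite_toSet.subset support_indicator_subset),
    fun A hA => ?_⟩
  have h : (∑ i ∈ s, VectorMeasure.dirac (p i) (c i)) A
      = ∑ i ∈ s, (p ⁻¹' A).indicator ((s : Set ι).indicator c) i := by
    rw [FunLike.coe_sum, Finset.sum_apply]
    refine Finset.sum_congr rfl fun i hi => ?_
    by_cases hiA : p i ∈ A <;> simp [hiA, hA, hi]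
  rw [h]
  exact hasSum_sum_of_ne_finset_zero fun i hi => by simp [indicator, hi]

namespace IsAtomic

variable {ν : ComplexMeasure X} {p : ι → X} {c : ι → ℂ}

theorem sub (h : IsAtomic ν p c) {μ : ComplexMeasure X} {e : ι → ℂ} (h' : IsAtomic μ p e) :
    IsAtomic (ν - μ) p (c - e) :=
  ⟨h.summable.sub h'.summable, fun A hA => by
    rw [indicator_sub']
    exact (h.hasSum A hA).sub (h'.hasSum A hA)⟩

theorem smul (h : IsAtomic ν p c) (a : ℂ) : IsAtomic (a • ν) p (a • c) :=
  ⟨h.summable.const_smul a, fun A hA => by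
    rw [show (p ⁻¹' A).indicator (a • c) = a • (p ⁻¹' A).indicator c from
      indicator_const_smul _ a c]
    exact (h.hasSum A hA).const_smul a⟩

theorem map (h : IsAtomic ν p c) {φ : X → Y} (hφ : Measurable φ) :
    IsAtomic (ν.map φ) (φ ∘ p) c :=
  ⟨h.summable, fun A hA => by
    rw [VectorMeasure.map_apply _ hφ hA]
    exact h.hasSum _ (hφ hA)⟩

theorem mapRange (h : IsAtomic ν p c) {φ : ℂ →+ ℂ} (hφ : Continuous φ) :
    IsAtomic (ν.mapRange φ hφ) p (φ ∘ c) :=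
  ⟨h.summable.map φ hφ, fun A hA => by
    rw [VectorMeasure.mapRange_apply, indicator_comp_of_zero (map_zero φ)]
    exact (h.hasSum A hA).map φ hφ⟩

theorem variation_univ_le (h : IsAtomic ν p c) :
    ν.variation univ ≤ ENNReal.ofReal (∑' i, ‖c i‖) := by
  have hle : ν.variation ≤ Measure.sum fun i => ‖c i‖ₑ • Measure.dirac (p i) := by
    refine VectorMeasure.variation_le_of_forall_enorm_le fun A hA => ?_
    rw [← (h.hasSum A hA).tsum_eq, Measure.sum_apply _ hA]
    refine enorm_tsum_le_tsum_enorm.trans (ENNReal.tsum_le_tsum fun i => ?_)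
    by_cases hi : p i ∈ A <;> simp [hi, hA]
  refine (hle univ).trans_eq ?_
  simp [ENNReal.ofReal_tsum_of_nonneg (fun _ => norm_nonneg _) h.summable.norm]

theorem tendsto_variation_sub_sum_dirac (h : IsAtomic ν p c) :
    Tendsto (fun s : Finset ι =>
      (ν - ∑ i ∈ s, VectorMeasure.dirac (p i) (c i)).variation.real univ) atTop (𝓝 0) := by
  refine squeeze_zero (fun _ => measureReal_nonneg) (fun s => ?_)
    (tendsto_tsum_compl_atTop_zero fun i => ‖c i‖)
  have hs : IsAtomic (ν - ∑ i ∈ s, VectorMeasure.dirac (p i) (c i)) p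
      ((s : Set ι)ᶜ.indicator c) := by
    rw [indicator_compl]
    exact h.sub (isAtomic_sum_dirac p c s)
  calc _ ≤ ∑' i, ‖(s : Set ι)ᶜ.indicator c i‖ :=
        ENNReal.toReal_le_of_le_ofReal (tsum_nonneg fun _ => norm_nonneg _) hs.variation_univ_le
    _ = ∑' i : {i // i ∉ s}, ‖c i‖ := by
        simp only [norm_indicator_eq_indicator_norm]
        exact (tsum_subtype (s : Set ι)ᶜ fun i => ‖c i‖).symm

theorem hasSum_integral (h : IsAtomic ν p c) {g : X → ℂ} (hg : StronglyMeasurable g) {C : ℝ}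
    (hC : ∀ x, ‖g x‖ ≤ C) :
    HasSum (fun i => g (p i) * c i) (∫ᵛ x, g x ∂[ContinuousLinearMap.mul ℝ ℂ; ν]) := by
  have hint (μ : ComplexMeasure X) : μ.Integrable g :=
    Integrable.of_bound hg.aestronglyMeasurable C (Eventually.of_forall hC)
  rw [HasSum, SummationFilter.unconditional_filter, tendsto_iff_norm_sub_tendsto_zero]
  have hlim := h.tendsto_variation_sub_sum_dirac.const_mul (C * ‖ContinuousLinearMap.mul ℝ ℂ‖)
  rw [mul_zero] at hlim
  refine squeeze_zero (fun _ => norm_nonneg _) (fun s => ?_) hlim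
  have hsub : ∫ᵛ x, g x ∂[ContinuousLinearMap.mul ℝ ℂ; ν] - ∑ i ∈ s, g (p i) * c i
      = ∫ᵛ x, g x ∂[ContinuousLinearMap.mul ℝ ℂ;
        ν - ∑ i ∈ s, VectorMeasure.dirac (p i) (c i)] := by
    rw [VectorMeasure.integral_sub_vectorMeasure (hint _) (hint _),
      VectorMeasure.integral_finsetSum_vectorMeasure fun i _ => hint _]
    simp only [VectorMeasure.integral_dirac' hg, ContinuousLinearMap.mul_apply']
  rw [norm_sub_rev, hsub]
  exact VectorMeasure.norm_integral_le_of_norm_le_const (Eventually.of_forall hC)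

theorem prod (h : IsAtomic ν p c) {μ : ComplexMeasure Y} {q : κ → Y} {e : κ → ℂ}
    (h' : IsAtomic μ q e) :
    IsAtomic (ν.prod μ (ContinuousLinearMap.mul ℝ ℂ)) (fun i : ι × κ => (p i.1, q i.2))
      (fun i => c i.1 * e i.2) := by
  have hs : Summable fun i : ι × κ => c i.1 * e i.2 :=
    summable_mul_of_summable_norm h.summable.norm h'.summable.norm
  refine ⟨hs, fun A hA => ?_⟩
  have hflip : (ContinuousLinearMap.mul ℝ ℂ).flip = ContinuousLinearMap.mul ℝ ℂ := by
    ext; simp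
  rw [VectorMeasure.prod_apply_eq_integral hA, hflip]
  have hfibre (i : ι) : HasSum
      (fun k => ((fun i : ι × κ => (p i.1, q i.2)) ⁻¹' A).indicator
        (fun i : ι × κ => c i.1 * e i.2) (i, k)) (μ (Prod.mk (p i) ⁻¹' A) * c i) := by
    convert! (h'.hasSum _ (measurable_prodMk_left (x := p i) hA)).mul_right (c i) using 1
    funext k
    by_cases hk : (p i, q k) ∈ A <;> simp [hk, mul_comm]
  have hsum := (hs.indicator ((fun i : ι × κ => (p i.1, q i.2)) ⁻¹' A)).hasSum
  have hint := h.hasSum_integral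
    (VectorMeasure.stronglyMeasurable_vectorMeasure_prodMk_left (ν := μ) hA)
    (C := μ.bound) fun x => VectorMeasure.norm_apply_le_bound
  rwa [(hsum.prod_fiberwise hfibre).unique hint] at hsum

end IsAtomic

end AtomicMeasures

section Combs

theorem indicator_range_inter_comp {E ι M : Type*} [Zero M] (p : ι → E) (c : E → M)
    (B : Set E) :
    (range p ∩ B).indicator c ∘ p = (p ⁻¹' B).indicator (c ∘ p) := by
  rw [← preimage_range_inter]
  rfl

variable {E ι : Type*} [NormedAddCommGroup E] {p : ι → E} {S : Set E} {c : E → ℂ}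

theorem locallySummable_range_iff (hp : Function.Injective p) :
    LocallySummable (range p) c ↔
      ∀ B, IsBounded B → Summable ((p ⁻¹' B).indicator (c ∘ p)) := by
  refine forall₂_congr fun B _ => ?_
  rw [← indicator_range_inter_comp, hp.summable_iff]
  exact fun x hx => indicator_of_notMem (fun hx' => hx hx'.1) _

variable [MeasurableSpace E]

theorem LocalComplexMeasure.restrict_apply (μ : LocalComplexMeasure E) {B A : Set E}
    (hB : MeasurableSet B) (hB' : IsBounded B) (hA : MeasurableSet A) :
    μ.restrict B A = μ.measureOf (A ∩ B) := by
  rw [LocalComplexMeasure.restrict, dif_pos ⟨hB, hB'⟩]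
  exact if_pos hA

theorem hasSum_measureOf_diracComb (h : LocallySummable S c) {A : Set E}
    (hA : MeasurableSet A) (hA' : IsBounded A) :
    HasSum ((S ∩ A).indicator c) ((diracComb S c).measureOf A) := by
  rw [show (diracComb S c).measureOf A = ∑' x, (S ∩ A).indicator c x from if_pos ⟨h, hA, hA'⟩]
  exact (h A hA').hasSum

theorem purePoint_diracComb [MeasurableSingletonClass E] (h : LocallySummable S c) :
    (diracComb S c).PurePoint := by
  intro A hA hA'
  have hpoint (x : A) : (diracComb S c).measureOf {(x : E)} = S.indicator c x := by
    refine (hasSum_measureOf_diracComb h (measurableSet_singleton _) isBounded_singleton).unique ?_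
    rw [show S.indicator c x = (S ∩ {(x : E)}).indicator c x by
      by_cases hx : (x : E) ∈ S <;> simp [hx]]
    exact hasSum_single _ fun y hy => indicator_of_notMem (fun hy' => hy hy'.2) _
  simp_rw [hpoint]
  refine (hasSum_subtype_iff_indicator (f := S.indicator c)).2 ?_
  rw [indicator_indicator, inter_comm]
  exact hasSum_measureOf_diracComb h hA hA'

theorem isAtomic_restrict_diracComb_range (hp : Function.Injective p)
    (h : LocallySummable (range p) c) {B : Set E} (hB : MeasurableSet B) (hB' : IsBounded B) :
    IsAtomic ((diracComb (range p) c).restrict B) p ((p ⁻¹' B).indicator (c ∘ p)) := by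
  refine ⟨(locallySummable_range_iff hp).1 h B hB', fun A hA => ?_⟩
  rw [LocalComplexMeasure.restrict_apply _ hB hB' hA, indicator_indicator, ← preimage_inter,
    ← indicator_range_inter_comp, hp.hasSum_iff]
  · exact hasSum_measureOf_diracComb h (hA.inter hB) (hB'.subset inter_subset_right)
  · exact fun x hx => indicator_of_notMem (fun hx' => hx hx'.1) _

theorem hasSum_integral_diracComb_range [OpensMeasurableSpace E] (hp : Function.Injective p)
    (h : LocallySummable (range p) c) {g : E → ℂ} (hg : Continuous g) (hg' : HasCompactSupport g) :
    HasSum (fun i => g (p i) * c (p i)) ((diracComb (range p) c).integral g) := by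
  obtain ⟨C, hC⟩ := hg'.exists_bound_of_continuous hg
  convert (isAtomic_restrict_diracComb_range hp h (isClosed_tsupport g).measurableSet
    (IsCompact.isBounded hg')).hasSum_integral
      (hg.stronglyMeasurable_of_hasCompactSupport hg') hC using 2 with i
  · by_cases hi : p i ∈ tsupport g
    · simp [hi]
    · simp [image_eq_zero_of_notMem_tsupport hi]
  · rfl

end Combs

section Uniqueness

variable {E : Type*} [NormedAddCommGroup E] [MeasurableSpace E] [BorelSpace E]

namespace LocalComplexMeasure

theorem integral_eq_of_tsupport_subset (μ : LocalComplexMeasure E) {g : E → ℂ}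
    (hg : HasCompactSupport g) {B : Set E} (hB : MeasurableSet B) (hB' : IsBounded B)
    (hgB : tsupport g ⊆ B) :
    μ.integral g = ∫ᵛ x, g x ∂[ContinuousLinearMap.mul ℝ ℂ; μ.restrict B] := by
  have hm : MeasurableSet (tsupport g) := (isClosed_tsupport g).measurableSet
  have hb : IsBounded (tsupport g) := IsCompact.isBounded hg
  have hrestrict : μ.restrict (tsupport g) = (μ.restrict B).restrict (tsupport g) := by
    refine VectorMeasure.ext fun A hA => ?_
    rw [VectorMeasure.restrict_apply _ hm hA, restrict_apply _ hm hb hA,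
      restrict_apply _ hB hB' (hA.inter hm), inter_assoc, inter_eq_left.2 hgB]
  rw [LocalComplexMeasure.integral, hrestrict]
  exact VectorMeasure.setIntegral_eq_integral_of_forall_compl_eq_zero hm
    fun x hx => image_eq_zero_of_notMem_tsupport hx

variable [ProperSpace E]

theorem exists_tendsto_integral_measureOf {K : Set E} (hK : IsCompact K) :
    ∃ G : ℕ → E → ℂ, (∀ n, Continuous (G n)) ∧ (∀ n, HasCompactSupport (G n)) ∧
      ∀ μ : LocalComplexMeasure E,
        Tendsto (fun n => μ.integral (G n)) atTop (𝓝 (μ.measureOf K)) := by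
  obtain ⟨u, -, hu, hulim⟩ := exists_seq_strictAnti_tendsto' (zero_lt_one (α := ℝ))
  have hu0 (n : ℕ) : 0 < u n := (hu n).1
  let G : ℕ → E → ℂ := fun n x => ((thickenedIndicator (hu0 n) K x : NNReal) : ℝ)
  have hGc (n : ℕ) : Continuous (G n) := by fun_prop
  let B : Set E := Metric.cthickening 1 K
  have hB : IsCompact B := hK.cthickening
  have hGB (n : ℕ) : tsupport (G n) ⊆ B := by
    refine closure_minimal (fun x hx => by_contra fun hxB => hx ?_) hB.isClosed
    have hx' : x ∉ Metric.thickening (u n) K := fun h =>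
      hxB (Metric.thickening_subset_cthickening_of_le (hu n).2.le K h)
    simp only [G, thickenedIndicator_zero (hu0 n) K hx', NNReal.coe_zero, Complex.ofReal_zero]
  have hGcs (n : ℕ) : HasCompactSupport (G n) :=
    hB.of_isClosed_subset (isClosed_tsupport _) (hGB n)
  refine ⟨G, hGc, hGcs, fun μ => ?_⟩
  have hK_eq : μ.measureOf K = ∫ᵛ x, K.indicator (fun _ => (1 : ℂ)) x
      ∂[ContinuousLinearMap.mul ℝ ℂ; μ.restrict B] := by
    rw [VectorMeasure.integral_indicator_const _ hK.measurableSet,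
      restrict_apply _ hB.measurableSet hB.isBounded hK.measurableSet,
      inter_eq_left.2 (Metric.self_subset_cthickening K)]
    simp
  simp_rw [hK_eq, fun n => μ.integral_eq_of_tsupport_subset (hGcs n) hB.measurableSet
    hB.isBounded (hGB n)]
  refine VectorMeasure.tendsto_integral_filter_of_norm_le_const
    (Eventually.of_forall fun n => (hGc n).aestronglyMeasurable) ⟨1, ?_⟩ ?_
  · refine Eventually.of_forall fun n => Eventually.of_forall fun x => ?_
    simpa [G] using thickenedIndicator_le_one (hu0 n) K x
  · refine Eventually.of_forall fun x => ?_
    have hlim := tendsto_pi_nhds.1 (thickenedIndicator_tendsto_indicator_closure hu0 hulim K) x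
    rw [hK.isClosed.closure_eq] at hlim
    convert! (Complex.continuous_ofReal.tendsto _).comp
      ((NNReal.continuous_coe.tendsto _).comp hlim) using 2
    by_cases hx : x ∈ K <;> simp [hx]

theorem ext_of_isCompact {μ ν : LocalComplexMeasure E}
    (h : ∀ K, IsCompact K → μ.measureOf K = ν.measureOf K) : μ = ν := by
  ext A
  by_cases hA : MeasurableSet A ∧ IsBounded A
  · obtain ⟨R, hR⟩ := hA.2.subset_closedBall 0
    have hB : IsCompact (Metric.closedBall (0 : E) R) := isCompact_closedBall 0 R
    have hrestrict : μ.restrict (Metric.closedBall 0 R) = ν.restrict (Metric.closedBall 0 R) := by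
      refine VectorMeasure.ext_of_generateFrom {s : Set E | IsClosed s} (fun s hs => ?_)
        (BorelSpace.measurable_eq.trans borel_eq_generateFrom_isClosed) isPiSystem_isClosed ?_
      · simp only [restrict_apply _ hB.measurableSet hB.isBounded (IsClosed.measurableSet hs)]
        exact h _ (hB.inter_left hs)
      · simp only [restrict_apply _ hB.measurableSet hB.isBounded MeasurableSet.univ, univ_inter]
        exact h _ hB
    simpa only [restrict_apply _ hB.measurableSet hB.isBounded hA.1, inter_eq_left.2 hR]
      using congrArg (fun ν : ComplexMeasure E => ν A) hrestrict
  · rw [μ.eq_zero_of_not A hA, ν.eq_zero_of_not A hA]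

theorem ext_of_integral {μ ν : LocalComplexMeasure E}
    (h : ∀ g : E → ℂ, Continuous g → HasCompactSupport g → μ.integral g = ν.integral g) :
    μ = ν := by
  refine ext_of_isCompact fun K hK => ?_
  obtain ⟨G, hG, hG', hlim⟩ := exists_tendsto_integral_measureOf hK
  refine tendsto_nhds_unique (hlim μ) ?_
  simpa only [h _ (hG _) (hG' _)] using hlim ν

end LocalComplexMeasure

end Uniqueness

section WienerAmalgam

open Metric

variable {F β : Type*} [NormedAddCommGroup F] [NormedAddCommGroup β]

/-- The local supremum `sup {‖f (u + x)‖ : ‖x‖ ≤ ρ}` of `f` near `u`. -/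
def localSup (ρ : ℝ) (f : F → β) (u : F) : ℝ :=
  sSup ((fun x => ‖f (u + x)‖) '' closedBall 0 ρ)

/-- `f` belongs to the Wiener amalgam space `W(C, L¹)`: it is continuous and its local suprema are
integrable. This is the class of functions with which lattice points can be weighted. -/
structure WienerAmalgam [MeasureSpace F] (f : F → β) : Prop where
  continuous : Continuous f
  integrable_localSup : ∀ ρ, Integrable (localSup ρ f)

theorem localSup_nonneg (ρ : ℝ) (f : F → β) (u : F) : 0 ≤ localSup ρ f u :=
  Real.sSup_nonneg (forall_mem_image.2 fun _ _ => norm_nonneg _)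

theorem localSup_le {ρ M : ℝ} {f : F → β} {u : F} (hM : 0 ≤ M)
    (h : ∀ x, ‖x‖ ≤ ρ → ‖f (u + x)‖ ≤ M) : localSup ρ f u ≤ M :=
  Real.sSup_le (forall_mem_image.2 fun x hx => h x (mem_closedBall_zero_iff.1 hx)) hM

variable [ProperSpace F] {f : F → β}

theorem norm_le_localSup (hf : Continuous f) {ρ : ℝ} {x : F} (hx : ‖x‖ ≤ ρ) (u : F) :
    ‖f (u + x)‖ ≤ localSup ρ f u :=
  le_csSup ((isCompact_closedBall 0 ρ).image (by fun_prop)).bddAbove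
    (mem_image_of_mem _ (mem_closedBall_zero_iff.2 hx))

theorem norm_le_localSup_self (hf : Continuous f) {ρ : ℝ} (hρ : 0 ≤ ρ) (u : F) :
    ‖f u‖ ≤ localSup ρ f u := by
  simpa using norm_le_localSup hf (norm_zero.trans_le hρ) u

theorem continuous_localSup_uncurry {T : Type*} [TopologicalSpace T] {g : T → F → β}
    (hg : Continuous ↿g) (ρ : ℝ) : Continuous fun p : T × F => localSup ρ (g p.1) p.2 :=
  (isCompact_closedBall 0 ρ).continuous_sSup
    (hg.comp (f := fun q : (T × F) × F => (q.1.1, q.1.2 + q.2)) (by fun_prop)).norm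

theorem continuous_localSup (hf : Continuous f) (ρ : ℝ) : Continuous (localSup ρ f) :=
  (continuous_localSup_uncurry (g := fun _ : Unit => f) (hf.comp continuous_snd) ρ).comp
    (Continuous.prodMk_right ())

theorem localSup_localSup_le (hf : Continuous f) (ρ R : ℝ) (u : F) :
    localSup ρ (localSup R f) u ≤ localSup (ρ + R) f u := by
  refine localSup_le (localSup_nonneg _ _ _) fun x hx => ?_
  rw [Real.norm_of_nonneg (localSup_nonneg _ _ _)]
  refine localSup_le (localSup_nonneg _ _ _) fun y hy => ?_
  rw [add_assoc]
  exact norm_le_localSup hf ((norm_add_le x y).trans (add_le_add hx hy)) u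

namespace WienerAmalgam

variable [MeasureSpace F] [BorelSpace F]

theorem of_localSup_le (hf : Continuous f) {H : ℝ → F → ℝ} (hH : ∀ ρ, Integrable (H ρ))
    (hle : ∀ ρ u, localSup ρ f u ≤ H ρ u) : WienerAmalgam f :=
  ⟨hf, fun ρ => (hH ρ).mono' (continuous_localSup hf ρ).aestronglyMeasurable
    (Eventually.of_forall fun u =>
      (Real.norm_of_nonneg (localSup_nonneg _ _ _)).trans_le (hle ρ u))⟩

theorem integrable [SecondCountableTopologyEither F β] (hf : WienerAmalgam f) : Integrable f :=
  (hf.integrable_localSup 0).mono' hf.continuous.aestronglyMeasurable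
    (Eventually.of_forall (norm_le_localSup_self hf.continuous le_rfl))

protected theorem localSup (hf : WienerAmalgam f) (R : ℝ) : WienerAmalgam (localSup R f) :=
  of_localSup_le (continuous_localSup hf.continuous R)
    (fun ρ => hf.integrable_localSup (ρ + R)) fun ρ u => localSup_localSup_le hf.continuous ρ R u

theorem exists_norm_le [(volume : Measure F).IsAddHaarMeasure] (hf : WienerAmalgam f) :
    ∃ C, ∀ u, ‖f u‖ ≤ C := by
  have hpos : 0 < volume.real (closedBall (0 : F) 1) :=
    ENNReal.toReal_pos (measure_closedBall_pos _ _ one_pos).ne'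
      (isCompact_closedBall _ _).measure_ne_top
  refine ⟨(∫ u, localSup 1 f u) / volume.real (closedBall (0 : F) 1), fun u => ?_⟩
  rw [le_div_iff₀ hpos]
  calc ‖f u‖ * volume.real (closedBall (0 : F) 1)
      = ‖f u‖ * volume.real (closedBall u 1) := by
        simp only [Measure.real, Measure.addHaar_closedBall_center]
    _ ≤ ∫ y in closedBall u 1, localSup 1 f y := by
        refine setIntegral_ge_of_const_le_real measurableSet_closedBall
          (isCompact_closedBall _ _).measure_ne_top (fun y hy => ?_)
          (hf.integrable_localSup 1).integrableOn
        simpa using norm_le_localSup hf.continuous (x := u - y)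
          (by rwa [← dist_eq_norm, dist_comm]) y
    _ ≤ ∫ y, localSup 1 f y :=
        setIntegral_le_integral (hf.integrable_localSup 1)
          (Eventually.of_forall (localSup_nonneg 1 f))

theorem mul_bounded {R : Type*} [NormedRing R] {f h : F → R} (hf : WienerAmalgam f)
    (hh : Continuous h) {C : ℝ} (hC : ∀ u, ‖h u‖ ≤ C) : WienerAmalgam fun u => f u * h u := by
  have hC0 : 0 ≤ C := (norm_nonneg _).trans (hC 0)
  refine of_localSup_le (hf.continuous.mul hh) (fun ρ => (hf.integrable_localSup ρ).mul_const C)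
    fun ρ u => localSup_le (mul_nonneg (localSup_nonneg _ _ _) hC0) fun x hx => ?_
  exact (norm_mul_le _ _).trans (mul_le_mul (norm_le_localSup hf.continuous hx u) (hC _)
    (norm_nonneg _) (localSup_nonneg _ _ _))

theorem const_mul {R : Type*} [NormedCommRing R] {f : F → R} (hf : WienerAmalgam f) (c : R) :
    WienerAmalgam fun u => c * f u := by
  simpa only [mul_comm] using hf.mul_bounded continuous_const fun _ => le_refl ‖c‖

theorem sub {g : F → β} (hf : WienerAmalgam f) (hg : WienerAmalgam g) : WienerAmalgam (f - g) :=
  of_localSup_le (hf.continuous.sub hg.continuous)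
    (fun ρ => (hf.integrable_localSup ρ).add (hg.integrable_localSup ρ)) fun _ u =>
    localSup_le (add_nonneg (localSup_nonneg _ _ _) (localSup_nonneg _ _ _)) fun _ hx =>
      (norm_sub_le _ _).trans (add_le_add (norm_le_localSup hf.continuous hx u)
        (norm_le_localSup hg.continuous hx u))

theorem comp_add_right [(volume : Measure F).IsAddHaarMeasure] (hf : WienerAmalgam f) (w : F) :
    WienerAmalgam fun u => f (u + w) :=
  of_localSup_le (hf.continuous.comp (continuous_add_const w))
    (fun ρ => (hf.integrable_localSup ρ).comp_add_right w) fun ρ u =>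
    localSup_le (localSup_nonneg _ _ _) fun x hx => by
      rw [add_right_comm]
      exact norm_le_localSup hf.continuous hx (u + w)

theorem tendsto_integral_localSup_translate_sub [(volume : Measure F).IsAddHaarMeasure]
    (hf : WienerAmalgam f) (ρ : ℝ) :
    Tendsto (fun w => ∫ u, localSup ρ (fun y => f (y + w) - f y) u) (𝓝 0) (𝓝 0) := by
  have hcont := continuous_localSup_uncurry (T := F) (g := fun w y => f (y + w) - f y)
    (by have := hf.continuous; simp only [Function.HasUncurry.uncurry, id]; fun_prop) ρ
  have hbound {w : F} (hw : ‖w‖ ≤ 1) (u : F) :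
      localSup ρ (fun y => f (y + w) - f y) u
        ≤ localSup (ρ + 1) f u + localSup ρ f u := by
    refine localSup_le (add_nonneg (localSup_nonneg _ _ _) (localSup_nonneg _ _ _)) fun x hx => ?_
    refine (norm_sub_le _ _).trans (add_le_add ?_ (norm_le_localSup hf.continuous hx u))
    rw [add_assoc]
    exact norm_le_localSup hf.continuous ((norm_add_le x w).trans (add_le_add hx hw)) u
  have hzero : ∫ u, localSup ρ (fun y => f (y + 0) - f y) u = 0 := by
    refine integral_eq_zero_of_ae (Eventually.of_forall fun u => ?_)
    exact (localSup_le le_rfl fun x _ => by simp).antisymm (localSup_nonneg _ _ _)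
  rw [← hzero]
  refine continuousAt_of_dominated
    (bound := fun u => localSup (ρ + 1) f u + localSup ρ f u)
    (Eventually.of_forall fun w => (hcont.comp (Continuous.prodMk_right w)).aestronglyMeasurable)
    ?_ ((hf.integrable_localSup _).add (hf.integrable_localSup _))
    (Eventually.of_forall fun u => (hcont.comp (Continuous.prodMk_left u)).continuousAt)
  filter_upwards [closedBall_mem_nhds (0 : F) one_pos] with w hw
  refine Eventually.of_forall fun u => ?_
  rw [Real.norm_of_nonneg (localSup_nonneg _ _ _)]
  exact hbound (mem_closedBall_zero_iff.1 hw) u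

end WienerAmalgam

end WienerAmalgam

section Autocorr

variable {F 𝕜 : Type*} [NormedAddCommGroup F] [RCLike 𝕜] [MeasureSpace F] {f : F → 𝕜}

/-- The autocorrelation `v ↦ ∫ f(u) conj (f(u - v)) du` of a function. -/
def autocorr (f : F → 𝕜) (v : F) : 𝕜 := ∫ u, f u * starRingEnd 𝕜 (f (u - v))

namespace WienerAmalgam

variable [NormedSpace ℝ F] [FiniteDimensional ℝ F] [BorelSpace F]
  [(volume : Measure F).IsAddHaarMeasure]

theorem mul_conj_translate (hf : WienerAmalgam f) (v : F) :
    WienerAmalgam fun u => f u * starRingEnd 𝕜 (f (u - v)) := by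
  have := FiniteDimensional.proper_real F
  obtain ⟨C, hC⟩ := hf.exists_norm_le
  exact hf.mul_bounded (h := fun u => starRingEnd 𝕜 (f (u - v)))
    (RCLike.continuous_conj.comp (hf.continuous.comp (continuous_sub_right v)))
    fun u => (RCLike.norm_conj _).trans_le (hC _)

theorem continuous_autocorr (hf : WienerAmalgam f) : Continuous (autocorr f) := by
  have := FiniteDimensional.proper_real F
  obtain ⟨C, hC⟩ := hf.exists_norm_le
  refine continuous_of_dominated (bound := fun u => ‖f u‖ * C)
    (fun v => (hf.mul_conj_translate v).continuous.aestronglyMeasurable) (fun v => ?_)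
    (hf.integrable.norm.mul_const C) (Eventually.of_forall fun u => ?_)
  · refine Eventually.of_forall fun u => ?_
    rw [norm_mul, RCLike.norm_conj]
    exact mul_le_mul_of_nonneg_left (hC _) (norm_nonneg _)
  · exact continuous_const.mul (RCLike.continuous_conj.comp
      (hf.continuous.comp (continuous_sub_left u)))

theorem localSup_autocorr_le (hf : WienerAmalgam f) (ρ : ℝ) (v : F) :
    localSup ρ (autocorr f) v ≤ ∫ u, ‖f u‖ * localSup ρ f (u - v) := by
  have := FiniteDimensional.proper_real F
  obtain ⟨C, hC⟩ := (hf.localSup ρ).exists_norm_le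
  have hint : Integrable fun u => ‖f u‖ * localSup ρ f (u - v) :=
    hf.integrable.norm.mul_bdd (c := C)
      ((hf.localSup ρ).continuous.comp (continuous_sub_right v)).aestronglyMeasurable
      (Eventually.of_forall fun u => hC _)
  refine localSup_le (integral_nonneg fun u => mul_nonneg (norm_nonneg _) (localSup_nonneg _ _ _))
    fun x hx => norm_integral_le_of_norm_le hint (Eventually.of_forall fun u => ?_)
  rw [norm_mul, RCLike.norm_conj, sub_add_eq_sub_sub, sub_eq_add_neg _ x]
  exact mul_le_mul_of_nonneg_left (norm_le_localSup hf.continuous ((norm_neg x).trans_le hx) _)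
    (norm_nonneg _)

protected theorem autocorr (hf : WienerAmalgam f) : WienerAmalgam (autocorr f) := by
  have := FiniteDimensional.proper_real F
  refine .of_localSup_le hf.continuous_autocorr (fun ρ => ?_) hf.localSup_autocorr_le
  have hconv := hf.integrable.norm.integrable_convolution (ContinuousLinearMap.mul ℝ ℝ)
    (hf.integrable_localSup ρ).comp_neg
  refine hconv.congr (Eventually.of_forall fun v => ?_)
  simp only [convolution_def, ContinuousLinearMap.mul_apply', neg_sub]

end WienerAmalgam

end Autocorr

section Decay

variable {F β : Type*} [NormedAddCommGroup F] [NormedAddCommGroup β]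

theorem exists_norm_le_one_add_norm_rpow_neg [ProperSpace F] {f : F → β} (hf : Continuous f)
    {s C : ℝ} (hs : 0 ≤ s) (hdecay : ∀ x, ‖x‖ ^ s * ‖f x‖ ≤ C) :
    ∃ K, 0 ≤ K ∧ ∀ x, ‖f x‖ ≤ K * (1 + ‖x‖) ^ (-s) := by
  obtain ⟨M, hM⟩ := (isCompact_closedBall (0 : F) 1).exists_bound_of_continuousOn hf.continuousOn
  have hmax (x : F) : max 1 ‖x‖ ^ s * ‖f x‖ ≤ max M C := by
    rcases le_total ‖x‖ 1 with hx | hx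
    · rw [max_eq_left hx, Real.one_rpow, one_mul]
      exact le_max_of_le_left (hM x (mem_closedBall_zero_iff.2 hx))
    · rw [max_eq_right hx]
      exact le_max_of_le_right (hdecay x)
  refine ⟨2 ^ s * max M C, mul_nonneg (by positivity) (le_trans (by positivity) (hmax 0)),
    fun x => ?_⟩
  rw [Real.rpow_neg (by positivity), ← div_eq_mul_inv, le_div_iff₀' (by positivity)]
  calc (1 + ‖x‖) ^ s * ‖f x‖ ≤ (2 * max 1 ‖x‖) ^ s * ‖f x‖ := by
        gcongr
        linarith [le_max_left 1 ‖x‖, le_max_right 1 ‖x‖]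
    _ = 2 ^ s * (max 1 ‖x‖ ^ s * ‖f x‖) := by
        rw [Real.mul_rpow zero_le_two (by positivity), mul_assoc]
    _ ≤ 2 ^ s * max M C := by gcongr; exact hmax x

variable [NormedSpace ℝ F] [FiniteDimensional ℝ F] [MeasureSpace F] [BorelSpace F]
  [(volume : Measure F).IsAddHaarMeasure]

theorem WienerAmalgam.of_norm_rpow_mul_le {f : F → β} (hf : Continuous f) {s C : ℝ}
    (hs : (Module.finrank ℝ F : ℝ) < s) (hdecay : ∀ x, ‖x‖ ^ s * ‖f x‖ ≤ C) : WienerAmalgam f := by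
  have : ProperSpace F := FiniteDimensional.proper_real F
  have hs0 : 0 ≤ s := (Nat.cast_nonneg _).trans hs.le
  obtain ⟨K, hK0, hK⟩ := exists_norm_le_one_add_norm_rpow_neg hf hs0 hdecay
  refine .of_localSup_le hf (H := fun ρ u => K * (1 + |ρ|) ^ s * (1 + ‖u‖) ^ (-s))
    (fun ρ => (integrable_one_add_norm hs).const_mul _)
    fun ρ u => localSup_le (by positivity) fun x hx => ?_
  have hux : 1 + ‖u‖ ≤ (1 + |ρ|) * (1 + ‖u + x‖) := by
    have htri : ‖u‖ ≤ ‖u + x‖ + ‖x‖ := by simpa using norm_sub_le (u + x) x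
    nlinarith [le_abs_self ρ, norm_nonneg (u + x), abs_nonneg ρ]
  calc ‖f (u + x)‖ ≤ K * (1 + ‖u + x‖) ^ (-s) := hK _
    _ ≤ K * ((1 + |ρ|) ^ s * (1 + ‖u‖) ^ (-s)) := by
        gcongr
        rw [Real.rpow_neg (by positivity), Real.rpow_neg (by positivity), ← div_eq_mul_inv,
          inv_le_comm₀ (by positivity) (by positivity), inv_div, div_le_iff₀' (by positivity),
          ← Real.mul_rpow (by positivity) (by positivity)]
        gcongr
    _ = K * (1 + |ρ|) ^ s * (1 + ‖u‖) ^ (-s) := by ring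

end Decay

section Lattices

variable {V : Type*} [NormedAddCommGroup V] [NormedSpace ℝ V] [FiniteDimensional ℝ V]

theorem countable_lattice (Λ : Submodule ℤ V) [DiscreteTopology Λ] : Countable Λ :=
  TopologicalSpace.separableSpace_iff_countable.1 inferInstance

variable [MeasurableSpace V] [BorelSpace V] {μ : Measure V} [μ.IsAddHaarMeasure]

theorem exists_fundamentalDomain_subset_ball (μ : Measure V) [μ.IsAddHaarMeasure]
    (Λ : Submodule ℤ V) [DiscreteTopology Λ] [IsZLattice ℝ Λ] :
    ∃ (D : Set V) (ρ : ℝ), 0 < ρ ∧ IsAddFundamentalDomain Λ D μ ∧ D ⊆ Metric.ball 0 ρ := by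
  have : Module.Free ℤ Λ := ZLattice.module_free ℝ Λ
  let b := Module.Free.chooseBasis ℤ Λ
  obtain ⟨ρ, hρ, hbound⟩ :=
    (ZSpan.fundamentalDomain_isBounded (b.ofZLatticeBasis ℝ Λ)).exists_pos_norm_lt
  exact ⟨_, ρ, hρ, ZLattice.isAddFundamentalDomain b μ,
    fun x hx => mem_ball_zero_iff.2 (hbound x hx)⟩

variable {Λ : Submodule ℤ V} [DiscreteTopology Λ] {D : Set V}

theorem lintegral_eq_tsum_lattice (hD : IsAddFundamentalDomain Λ D μ) (H : V → ENNReal) :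
    ∫⁻ x, H x ∂μ = ∑' l : Λ, ∫⁻ x in D, H (l + x) ∂μ := by
  have := countable_lattice Λ
  have : MeasurableVAdd Λ V := (inferInstance : MeasurableVAdd Λ.toAddSubgroup V)
  have : VAddInvariantMeasure Λ V μ := (inferInstance : VAddInvariantMeasure Λ.toAddSubgroup V μ)
  exact hD.lintegral_eq_tsum'' H

variable {β : Type*} [NormedAddCommGroup β]

theorem setIntegral_tsum_lattice [NormedSpace ℝ β] (hD : IsAddFundamentalDomain Λ D μ) {H : V → β}
    (hH : Integrable H μ) (hHm : StronglyMeasurable H) :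
    ∫ x in D, ∑' l : Λ, H (l + x) ∂μ = ∫ x, H x ∂μ := by
  have := countable_lattice Λ
  have : MeasurableVAdd Λ V := (inferInstance : MeasurableVAdd Λ.toAddSubgroup V)
  have : VAddInvariantMeasure Λ V μ := (inferInstance : VAddInvariantMeasure Λ.toAddSubgroup V μ)
  rw [hD.integral_eq_tsum'' H hH]
  refine integral_tsum (fun l => (hHm.comp_measurable
    (measurable_const_add (l : V))).aestronglyMeasurable) ?_
  rw [← lintegral_eq_tsum_lattice hD fun x => ‖H x‖ₑ]
  exact hH.hasFiniteIntegral.ne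

variable [IsZLattice ℝ Λ] {H₀ : V → β} {H : V → ℝ}

theorem measure_fundamentalDomain (hD : IsAddFundamentalDomain Λ D μ) :
    μ D = ENNReal.ofReal (ZLattice.covolume Λ μ) := by
  have hcov := ZLattice.covolume_eq_measure_fundamentalDomain Λ μ hD
  have hfin : μ D ≠ ⊤ := fun htop =>
    ZLattice.covolume_ne_zero Λ μ (by rw [hcov, Measure.real, htop, ENNReal.toReal_top])
  rw [hcov, ofReal_measureReal hfin]

theorem nonneg_of_norm_le_add (hD : IsAddFundamentalDomain Λ D μ)
    (hle : ∀ x, ∀ y ∈ D, ‖H₀ x‖ ≤ H (x + y)) (x : V) : 0 ≤ H x := by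
  obtain ⟨y, hy⟩ : D.Nonempty := nonempty_of_measure_ne_zero <| by
    rw [measure_fundamentalDomain hD]
    exact (ENNReal.ofReal_pos.2 (ZLattice.covolume_pos Λ μ)).ne'
  simpa using (norm_nonneg _).trans (hle (x - y) y hy)

theorem tsum_enorm_lattice_le (hD : IsAddFundamentalDomain Λ D μ) (hH : Integrable H μ)
    (hle : ∀ x, ∀ y ∈ D, ‖H₀ x‖ ≤ H (x + y)) (q : V) :
    ∑' l : Λ, ‖H₀ (l + q)‖ₑ ≤ ENNReal.ofReal ((ZLattice.covolume Λ μ)⁻¹ * ∫ x, H x ∂μ) := by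
  have hmul : μ D * ∑' l : Λ, ‖H₀ (l + q)‖ₑ ≤ ENNReal.ofReal (∫ x, H x ∂μ) := calc
    μ D * ∑' l : Λ, ‖H₀ (l + q)‖ₑ = ∑' l : Λ, ∫⁻ _ in D, ‖H₀ (l + q)‖ₑ ∂μ := by
        simp only [setLIntegral_const, ENNReal.tsum_mul_right, mul_comm]
    _ ≤ ∑' l : Λ, ∫⁻ x in D, ENNReal.ofReal (H (l + x + q)) ∂μ := by
        refine ENNReal.tsum_le_tsum fun l => lintegral_mono_ae ?_
        filter_upwards [ae_restrict_mem₀ hD.nullMeasurableSet] with x hx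
        rw [← ofReal_norm, add_right_comm]
        exact ENNReal.ofReal_le_ofReal (hle _ x hx)
    _ = ENNReal.ofReal (∫ x, H x ∂μ) := by
        rw [← lintegral_eq_tsum_lattice hD fun x => ENNReal.ofReal (H (x + q)),
          lintegral_add_right_eq_self fun x => ENNReal.ofReal (H x),
          ofReal_integral_eq_lintegral_ofReal hH
            (Eventually.of_forall (nonneg_of_norm_le_add hD hle))]
  have hcov := ZLattice.covolume_pos Λ μ
  rw [measure_fundamentalDomain hD] at hmul
  rwa [ENNReal.ofReal_mul (inv_nonneg.2 hcov.le), ENNReal.ofReal_inv_of_pos hcov,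
    ← ENNReal.mul_le_iff_le_inv (ENNReal.ofReal_pos.2 hcov).ne' ENNReal.ofReal_ne_top]

theorem summable_norm_lattice (hD : IsAddFundamentalDomain Λ D μ) (hH : Integrable H μ)
    (hle : ∀ x, ∀ y ∈ D, ‖H₀ x‖ ≤ H (x + y)) (q : V) :
    Summable fun l : Λ => ‖H₀ (l + q)‖ :=
  tsum_enorm_ne_top_iff_summable_norm.1
    ((tsum_enorm_lattice_le hD hH hle q).trans_lt ENNReal.ofReal_lt_top).ne

theorem tsum_norm_lattice_le (hD : IsAddFundamentalDomain Λ D μ) (hH : Integrable H μ)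
    (hle : ∀ x, ∀ y ∈ D, ‖H₀ x‖ ≤ H (x + y)) (q : V) :
    ∑' l : Λ, ‖H₀ (l + q)‖ ≤ (ZLattice.covolume Λ μ)⁻¹ * ∫ x, H x ∂μ := by
  have hnonneg := nonneg_of_norm_le_add hD hle
  rw [← ENNReal.ofReal_le_ofReal_iff (mul_nonneg (inv_nonneg.2 (ZLattice.covolume_pos Λ μ).le)
      (integral_nonneg hnonneg)),
    ENNReal.ofReal_tsum_of_nonneg (fun _ => norm_nonneg _) (summable_norm_lattice hD hH hle q)]
  simpa only [ofReal_norm] using tsum_enorm_lattice_le hD hH hle q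

end Lattices

section Cylinders

open Metric

variable {E F β : Type*} [NormedAddCommGroup β]
  {A A' : Set E} {G G' : F → β}

/-- The function `(x, u) ↦ 1_A(x) G(u)` on the product of physical and internal space. -/
def cylinder (A : Set E) (G : F → β) : E × F → β :=
  (Prod.fst ⁻¹' A).indicator (G ∘ Prod.snd)

theorem stronglyMeasurable_cylinder [MeasurableSpace E] [TopologicalSpace F] [MeasurableSpace F]
    [OpensMeasurableSpace F] [SecondCountableTopology F] (hA : MeasurableSet A)
    (hG : Continuous G) :
    StronglyMeasurable (cylinder A G) :=
  (hG.stronglyMeasurable.comp_measurable measurable_snd).indicator (measurable_fst hA)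

theorem norm_cylinder_sub_cylinder (x : E × F) :
    ‖cylinder A G x - cylinder A' G x‖ = ‖cylinder (symmDiff A A') G x‖ := by
  rw [cylinder, cylinder, cylinder, preimage_symmDiff]
  exact (apply_indicator_symmDiff norm_neg _ _ _ _).symm

theorem norm_cylinder_le [NormedAddCommGroup E] [NormedAddCommGroup F] [ProperSpace F]
    (hG : Continuous G) {ρ : ℝ} (x : E × F) {y : E × F} (hy : y ∈ ball 0 ρ) :
    ‖cylinder A G x‖ ≤ cylinder (thickening ρ A) (localSup ρ G) (x + y) := by
  have hyρ : ‖y‖ < ρ := mem_ball_zero_iff.1 hy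
  by_cases hx : x.1 ∈ A
  · have hxy : (x + y).1 ∈ thickening ρ A := mem_thickening_iff.2
      ⟨x.1, hx, by simpa using (norm_fst_le y).trans_lt hyρ⟩
    rw [cylinder, cylinder, indicator_of_mem (mem_preimage.2 hx),
      indicator_of_mem (mem_preimage.2 hxy)]
    have := norm_le_localSup hG (x := -y.2) (ρ := ρ)
      ((norm_neg _).trans_le ((norm_snd_le y).trans hyρ.le)) (x + y).2
    simpa using this
  · rw [cylinder, indicator_of_notMem (by exact hx), norm_zero]
    exact indicator_nonneg (fun _ _ => localSup_nonneg _ _ _) _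

variable [MeasureSpace E] [MeasureSpace F] [SFinite (volume : Measure E)]
  [SFinite (volume : Measure F)]

theorem volume_restrict_preimage_fst (A : Set E) :
    (volume : Measure (E × F)).restrict (Prod.fst ⁻¹' A)
      = (volume.restrict A).prod (volume : Measure F) := by
  rw [← prod_univ, ← Measure.restrict_univ (μ := (volume : Measure F)), Measure.prod_restrict]
  rfl

theorem integrable_cylinder (hA : MeasurableSet A) (hA' : volume A ≠ ⊤) (hG : Integrable G) :
    Integrable (cylinder A G) := by
  have : IsFiniteMeasure (volume.restrict A) := isFiniteMeasure_restrict.2 hA'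
  rw [cylinder, integrable_indicator_iff (measurable_fst hA), IntegrableOn,
    volume_restrict_preimage_fst]
  exact hG.comp_snd _

theorem integral_cylinder [NormedSpace ℝ β] (hA : MeasurableSet A) :
    ∫ x, cylinder A G x = volume.real A • ∫ u, G u := by
  rw [cylinder, integral_indicator (measurable_fst hA), volume_restrict_preimage_fst]
  exact (integral_fun_snd G).trans (by rw [measureReal_restrict_apply_univ])

end Cylinders

section LatticeSums

open Metric

variable {E F β : Type*} [NormedAddCommGroup E] [NormedAddCommGroup F] [NormedAddCommGroup β]
  {Λ : Submodule ℤ (E × F)} {A A' : Set E} {G G' : F → β}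

/-- The sum of the weights `G` over the points of the translated lattice `Λ + q` above `A`. -/
def latticeSum (Λ : Submodule ℤ (E × F)) (A : Set E) (G : F → β) (q : E × F) : β :=
  ∑' l : Λ, cylinder A G (l + q)

theorem latticeSum_add_coe (l : Λ) (q : E × F) :
    latticeSum Λ A G (l + q) = latticeSum Λ A G q := by
  rw [latticeSum, latticeSum, ← (Equiv.addRight l).tsum_eq fun l' : Λ => cylinder A G (l' + q)]
  simp only [Equiv.coe_addRight, Submodule.coe_add, add_assoc]

theorem latticeSum_prodMk (t : E) (w : F) :
    latticeSum Λ A G (t, w) = latticeSum Λ A (fun u => G (u + w)) (t, 0) := by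
  classical simp [latticeSum, cylinder, indicator_apply]

theorem latticeSum_prodMk_zero (t : E) :
    latticeSum Λ A G (t, 0) = latticeSum Λ ((· + t) ⁻¹' A) G 0 := by
  classical simp [latticeSum, cylinder, indicator_apply]

variable [NormedSpace ℝ E] [FiniteDimensional ℝ E] [MeasureSpace E] [BorelSpace E]
  [(volume : Measure E).IsAddHaarMeasure]
  [NormedSpace ℝ F] [FiniteDimensional ℝ F] [MeasureSpace F]
  [(volume : Measure F).IsAddHaarMeasure] {D : Set (E × F)} {ρ : ℝ}

theorem integrable_cylinder_thickening (hA : IsBounded A) (hG : WienerAmalgam G) :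
    Integrable (cylinder (thickening ρ A) (localSup ρ G)) :=
  integrable_cylinder isOpen_thickening.measurableSet hA.thickening.measure_lt_top.ne
    (hG.integrable_localSup ρ)

variable [BorelSpace F]

instance isAddHaarMeasure_volume_prod : (volume : Measure (E × F)).IsAddHaarMeasure :=
  inferInstanceAs ((volume : Measure E).prod (volume : Measure F)).IsAddHaarMeasure

variable [DiscreteTopology Λ]

theorem setIntegral_latticeSum [NormedSpace ℝ β] (hD : IsAddFundamentalDomain Λ D volume)
    (hA : MeasurableSet A) (hA' : IsBounded A) (hG : WienerAmalgam G) :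
    ∫ q in D, latticeSum Λ A G q = volume.real A • ∫ u, G u := by
  rw [← integral_cylinder hA]
  exact setIntegral_tsum_lattice hD
    (integrable_cylinder hA hA'.measure_lt_top.ne hG.integrable)
    (stronglyMeasurable_cylinder hA hG.continuous)

variable [IsZLattice ℝ Λ]

theorem summable_norm_cylinder (hA : IsBounded A) (hG : WienerAmalgam G) (q : E × F) :
    Summable fun l : Λ => ‖cylinder A G (l + q)‖ := by
  obtain ⟨D, ρ, -, hD, hDρ⟩ := exists_fundamentalDomain_subset_ball volume Λ
  exact summable_norm_lattice hD (integrable_cylinder_thickening hA hG)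
    (fun x y hy => norm_cylinder_le hG.continuous x (hDρ hy)) q

theorem latticeSum_sub [CompleteSpace β] (hA : IsBounded A) (hG : WienerAmalgam G)
    (hG' : WienerAmalgam G') (q : E × F) :
    latticeSum Λ A (G - G') q = latticeSum Λ A G q - latticeSum Λ A G' q := by
  rw [latticeSum, latticeSum, latticeSum, ← (summable_norm_cylinder hA hG q).of_norm.tsum_sub
    (summable_norm_cylinder hA hG' q).of_norm]
  exact tsum_congr fun l => congrFun (indicator_sub' (Prod.fst ⁻¹' A) (G ∘ Prod.snd) _) _

theorem stronglyMeasurable_latticeSum [CompleteSpace β] (hA : MeasurableSet A)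
    (hA' : IsBounded A) (hG : WienerAmalgam G) : StronglyMeasurable (latticeSum Λ A G) := by
  have := countable_lattice Λ
  exact StronglyMeasurable.hasSum (L := .unconditional Λ)
    (fun l : Λ => (stronglyMeasurable_cylinder hA hG.continuous).comp_measurable
      (measurable_const_add (l : E × F)))
    fun q => (summable_norm_cylinder hA' hG q).of_norm.hasSum

variable (hD : IsAddFundamentalDomain Λ D volume) (hDρ : D ⊆ ball 0 ρ)

include hD hDρ

theorem tsum_norm_cylinder_le (hA : IsBounded A) (hG : WienerAmalgam G) (q : E × F) :
    ∑' l : Λ, ‖cylinder A G (l + q)‖ ≤ (ZLattice.covolume Λ volume)⁻¹ *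
      (volume.real (thickening ρ A) * ∫ u, localSup ρ G u) := by
  rw [← smul_eq_mul (volume.real _), ← integral_cylinder isOpen_thickening.measurableSet]
  exact tsum_norm_lattice_le hD (integrable_cylinder_thickening hA hG)
    (fun x y hy => norm_cylinder_le hG.continuous x (hDρ hy)) q

theorem norm_latticeSum_le (hA : IsBounded A) (hG : WienerAmalgam G) (q : E × F) :
    ‖latticeSum Λ A G q‖ ≤ (ZLattice.covolume Λ volume)⁻¹ *
      (volume.real (thickening ρ A) * ∫ u, localSup ρ G u) :=
  (norm_tsum_le_tsum_norm (summable_norm_cylinder hA hG q)).trans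
    (tsum_norm_cylinder_le hD hDρ hA hG q)

theorem norm_latticeSum_sub_le [CompleteSpace β] (hA : IsBounded A) (hA' : IsBounded A')
    (hG : WienerAmalgam G) (q : E × F) :
    ‖latticeSum Λ A G q - latticeSum Λ A' G q‖ ≤ (ZLattice.covolume Λ volume)⁻¹ *
      (volume.real (thickening ρ (symmDiff A A')) * ∫ u, localSup ρ G u) := by
  have hAA' : IsBounded (symmDiff A A') := (hA.union hA').subset symmDiff_subset_union
  rw [latticeSum, latticeSum, ← (summable_norm_cylinder hA hG q).of_norm.tsum_sub
    (summable_norm_cylinder hA' hG q).of_norm]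
  refine le_trans (norm_tsum_le_tsum_norm ?_) (le_of_eq_of_le ?_
    (tsum_norm_cylinder_le hD hDρ hAA' hG q))
  · simpa only [norm_cylinder_sub_cylinder] using summable_norm_cylinder hAA' hG q
  · simp only [norm_cylinder_sub_cylinder]

end LatticeSums

section Annuli

open Metric

variable {E : Type*} [NormedAddCommGroup E] {A : Set E} {r b ρ : ℝ}

/-- The annulus of half-width `b` around the sphere of radius `r`: the set that contains all
boundary effects of the ball `B_r` when it is moved or thickened. -/
def annulus (E : Type*) [NormedAddCommGroup E] (r b : ℝ) : Set E :=
  closedBall 0 (r + b) \ closedBall 0 (r - b)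

theorem thickening_closedBall_subset (x : E) :
    thickening ρ (closedBall x r) ⊆ closedBall x (r + ρ) := by
  intro y hy
  obtain ⟨z, hz, hyz⟩ := mem_thickening_iff.1 hy
  rw [mem_closedBall] at hz ⊢
  linarith [dist_triangle y z x]

theorem thickening_subset_annulus (hA : A ⊆ annulus E r b) :
    thickening ρ A ⊆ annulus E r (b + ρ) := by
  intro x hx
  refine ⟨?_, ?_⟩
  · rw [← add_assoc]
    exact thickening_closedBall_subset 0 (thickening_subset_of_subset ρ (hA.trans sdiff_subset) hx)
  · obtain ⟨y, hy, hxy⟩ := mem_thickening_iff.1 hx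
    have hy' := (hA hy).2
    rw [mem_closedBall] at hy' ⊢
    linarith [dist_triangle_left y 0 x]

theorem symmDiff_preimage_add_subset_annulus (t : E) (r : ℝ) :
    symmDiff ((· + t) ⁻¹' closedBall 0 r) (closedBall 0 r) ⊆ annulus E r ‖t‖ := by
  intro x hx
  have h1 := norm_add_le x t
  have h2 := norm_sub_le (x + t) t
  rw [add_sub_cancel_right] at h2
  simp only [annulus, mem_symmDiff, mem_preimage, mem_closedBall_zero_iff, Set.mem_sdiff, not_le]
    at hx ⊢
  rcases hx with hx | hx <;> constructor <;> linarith [norm_nonneg t]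

variable [NormedSpace ℝ E] [FiniteDimensional ℝ E] [MeasureSpace E]
  [(volume : Measure E).IsAddHaarMeasure]

theorem volume_real_closedBall_pos (hr : 0 < r) : 0 < volume.real (closedBall (0 : E) r) :=
  ENNReal.toReal_pos (measure_closedBall_pos volume 0 hr).ne' measure_closedBall_lt_top.ne

variable [BorelSpace E]

theorem tendsto_volume_closedBall_add_div (a : ℝ) :
    Tendsto (fun r : ℝ => volume.real (closedBall (0 : E) (r + a))
      / volume.real (closedBall (0 : E) r)) atTop (𝓝 1) := by
  have h1 : Tendsto (fun r : ℝ => (1 + a / r) ^ Module.finrank ℝ E) atTop (𝓝 1) := by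
    simpa using ((tendsto_const_nhds (x := (1 : ℝ))).add
      ((tendsto_const_nhds (x := a)).div_atTop tendsto_id)).pow (Module.finrank ℝ E)
  refine h1.congr' ?_
  filter_upwards [eventually_gt_atTop 0, eventually_ge_atTop (-a)] with r hr hra
  have hc : volume.real (closedBall (0 : E) 1) ≠ 0 := (volume_real_closedBall_pos one_pos).ne'
  rw [Measure.addHaar_real_closedBall' volume (0 : E) (by linarith : 0 ≤ r + a),
    Measure.addHaar_real_closedBall' volume (0 : E) hr.le, mul_div_mul_right _ _ hc, ← div_pow,
    add_div, div_self hr.ne']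

theorem tendsto_volume_annulus_div (hb : 0 ≤ b) :
    Tendsto (fun r : ℝ => volume.real (annulus E r b) / volume.real (closedBall (0 : E) r))
      atTop (𝓝 0) := by
  have h := (tendsto_volume_closedBall_add_div (E := E) b).sub
    (tendsto_volume_closedBall_add_div (E := E) (-b))
  rw [sub_self] at h
  refine h.congr fun r => ?_
  rw [annulus, measureReal_sdiff (closedBall_subset_closedBall (by linarith))
    isClosed_closedBall.measurableSet measure_closedBall_lt_top.ne, sub_div, sub_eq_add_neg r]

theorem eventually_volume_closedBall_add_le (a : ℝ) :
    ∀ᶠ r : ℝ in atTop, volume.real (closedBall (0 : E) (r + a))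
      ≤ 2 * volume.real (closedBall (0 : E) r) := by
  filter_upwards [(tendsto_volume_closedBall_add_div (E := E) a).eventually
    (gt_mem_nhds one_lt_two), eventually_gt_atTop 0] with r hr hr0
  exact ((div_lt_iff₀ (volume_real_closedBall_pos hr0)).1 hr).le

end Annuli

section Equidistribution

open Metric

variable {E F β : Type*}
  [NormedAddCommGroup E] [NormedSpace ℝ E] [FiniteDimensional ℝ E]
  [MeasureSpace E] [BorelSpace E] [(volume : Measure E).IsAddHaarMeasure]
  [NormedAddCommGroup F] [NormedSpace ℝ F] [FiniteDimensional ℝ F]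
  [MeasureSpace F] [BorelSpace F] [(volume : Measure F).IsAddHaarMeasure]
  [NormedAddCommGroup β] [NormedSpace ℝ β]
  {Λ : Submodule ℤ (E × F)} [DiscreteTopology Λ] {D : Set (E × F)} {ρ : ℝ} {G : F → β}

/-- The average of `G` over the points of the translated lattice `Λ + q` above the ball `B_r`,
normalised by the volume of `B_r` instead of the number of points. -/
def latticeMean (Λ : Submodule ℤ (E × F)) (r : ℝ) (G : F → β) (q : E × F) : β :=
  (volume.real (closedBall (0 : E) r))⁻¹ • latticeSum Λ (closedBall 0 r) G q

theorem setIntegral_latticeMean (hD : IsAddFundamentalDomain Λ D volume) (hG : WienerAmalgam G)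
    {r : ℝ} (hr : 0 < r) : ∫ q in D, latticeMean Λ r G q = ∫ u, G u := by
  simp only [latticeMean]
  rw [integral_smul, setIntegral_latticeSum hD isClosed_closedBall.measurableSet
    isBounded_closedBall hG, inv_smul_smul₀ (volume_real_closedBall_pos hr).ne']

variable [IsZLattice ℝ Λ]

theorem eventually_norm_inv_smul_latticeSum_le (hD : IsAddFundamentalDomain Λ D volume)
    (hDρ : D ⊆ ball 0 ρ) :
    ∀ᶠ r : ℝ in atTop, ∀ A ⊆ closedBall (0 : E) r, ∀ G : F → β, WienerAmalgam G → ∀ q,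
      ‖(volume.real (closedBall (0 : E) r))⁻¹ • latticeSum Λ A G q‖
        ≤ 2 * ((ZLattice.covolume Λ volume)⁻¹ * ∫ u, localSup ρ G u) := by
  filter_upwards [eventually_volume_closedBall_add_le (E := E) ρ, eventually_gt_atTop 0]
    with r hr hr0 A hA G hG q
  have hI : 0 ≤ ∫ u, localSup ρ G u := integral_nonneg fun _ => localSup_nonneg _ _ _
  have hc : 0 ≤ (ZLattice.covolume Λ volume)⁻¹ := inv_nonneg.2 (ZLattice.covolume_pos Λ volume).le
  have hV := volume_real_closedBall_pos (E := E) hr0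
  rw [norm_smul, norm_inv, Real.norm_of_nonneg hV.le, inv_mul_le_iff₀ hV]
  calc ‖latticeSum Λ A G q‖
      ≤ (ZLattice.covolume Λ volume)⁻¹ *
          (volume.real (thickening ρ A) * ∫ u, localSup ρ G u) :=
        norm_latticeSum_le hD hDρ (isBounded_closedBall.subset hA) hG q
    _ ≤ (ZLattice.covolume Λ volume)⁻¹ *
          (2 * volume.real (closedBall (0 : E) r) * ∫ u, localSup ρ G u) := by
        gcongr
        exact (measureReal_mono ((thickening_subset_of_subset ρ hA).trans
          (thickening_closedBall_subset 0)) measure_closedBall_lt_top.ne).trans hr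
    _ = _ := by ring

variable [CompleteSpace β]

theorem tendsto_inv_smul_latticeSum_sub (hG : WienerAmalgam G) {A : ℝ → Set E} {b : ℝ}
    (hb : 0 ≤ b) (hA : ∀ r, symmDiff (A r) (closedBall 0 r) ⊆ annulus E r b) (q : E × F) :
    Tendsto (fun r : ℝ => (volume.real (closedBall (0 : E) r))⁻¹ •
      (latticeSum Λ (A r) G q - latticeSum Λ (closedBall 0 r) G q)) atTop (𝓝 0) := by
  obtain ⟨D, ρ, hρ, hD, hDρ⟩ := exists_fundamentalDomain_subset_ball volume Λ
  have hlim := (tendsto_volume_annulus_div (E := E) (b := b + ρ) (by positivity)).mul_const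
    ((ZLattice.covolume Λ volume)⁻¹ * ∫ u, localSup ρ G u)
  rw [zero_mul] at hlim
  refine squeeze_zero_norm (fun r => ?_) hlim
  have hbd : IsBounded (annulus E r b) := isBounded_closedBall.subset sdiff_subset
  have hAr : IsBounded (A r) := (hbd.union isBounded_closedBall).subset fun x hx => by
    by_cases h : x ∈ closedBall (0 : E) r
    exacts [Or.inr h, Or.inl (hA r (Or.inl ⟨hx, h⟩))]
  have hI : 0 ≤ ∫ u, localSup ρ G u := integral_nonneg fun _ => localSup_nonneg _ _ _
  have hc : 0 ≤ (ZLattice.covolume Λ volume)⁻¹ := inv_nonneg.2 (ZLattice.covolume_pos Λ volume).le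
  rw [norm_smul, norm_inv, Real.norm_of_nonneg measureReal_nonneg]
  calc _ ≤ (volume.real (closedBall (0 : E) r))⁻¹ * ((ZLattice.covolume Λ volume)⁻¹ *
          (volume.real (annulus E r (b + ρ)) * ∫ u, localSup ρ G u)) := by
        gcongr
        refine (norm_latticeSum_sub_le hD hDρ hAr isBounded_closedBall hG q).trans ?_
        gcongr
        exacts [(measure_mono sdiff_subset).trans_lt measure_closedBall_lt_top |>.ne,
          thickening_subset_annulus (hA r)]
    _ = _ := by ring

theorem eventually_norm_latticeMean_sub_le (hdense : Dense (Prod.snd '' (Λ : Set (E × F))))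
    (hG : WienerAmalgam G) (q : E × F) {ε : ℝ} (hε : 0 < ε) :
    ∀ᶠ r in atTop, ‖latticeMean Λ r G q - latticeMean Λ r G 0‖ < ε := by
  obtain ⟨D, ρ, -, hD, hDρ⟩ := exists_fundamentalDomain_subset_ball volume Λ
  have hsmall : ∀ᶠ u in 𝓝 q.2, 2 * ((ZLattice.covolume Λ volume)⁻¹ *
      ∫ y, localSup ρ (fun y => G (y + (q.2 - u)) - G y) y) < ε / 2 := by
    have hu : Tendsto (fun u => q.2 - u) (𝓝 q.2) (𝓝 0) := by
      simpa using (continuous_const.sub continuous_id).tendsto (f := fun u => q.2 - u) q.2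
    have := (((hG.tendsto_integral_localSup_translate_sub ρ).comp hu).const_mul
      (ZLattice.covolume Λ volume)⁻¹).const_mul 2
    rw [mul_zero, mul_zero] at this
    exact this.eventually (gt_mem_nhds (half_pos hε))
  obtain ⟨_, ⟨l, hlΛ, rfl⟩, hl⟩ := hdense.inter_nhds_nonempty hsmall
  set t := q.1 - l.1
  set w := q.2 - l.2
  have hshift : ∀ r, latticeMean Λ r G q - latticeMean Λ r G 0
      = (volume.real (closedBall (0 : E) r))⁻¹ • latticeSum Λ (closedBall 0 r)
          ((fun u => G (u + w)) - G) (t, 0)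
        + (volume.real (closedBall (0 : E) r))⁻¹ • (latticeSum Λ ((· + t) ⁻¹' closedBall 0 r) G 0
          - latticeSum Λ (closedBall 0 r) G 0) := fun r => by
    have hq : q = (⟨l, hlΛ⟩ : Λ) + (t, w) := by ext <;> simp [t, w]
    rw [latticeMean, latticeMean, hq, latticeSum_add_coe, latticeSum_prodMk, ← smul_add, ← smul_sub,
      latticeSum_sub isBounded_closedBall (hG.comp_add_right w) hG, latticeSum_prodMk_zero (G := G),
      sub_add_sub_cancel]
  filter_upwards [eventually_norm_inv_smul_latticeSum_le (β := β) hD hDρ,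
    (tendsto_inv_smul_latticeSum_sub (Λ := Λ) hG (norm_nonneg t)
      (symmDiff_preimage_add_subset_annulus t) 0).norm.eventually
        (gt_mem_nhds (by rw [norm_zero]; exact half_pos hε))] with r hr hr'
  rw [hshift, ← add_halves ε]
  exact (norm_add_le _ _).trans_lt (add_lt_add
    ((hr _ Subset.rfl _ ((hG.comp_add_right w).sub hG) _).trans_lt hl) hr')

/-- Averaged over a fundamental domain of translates, the mean of `G` is exact; by density of the
internal projection, all translates have asymptotically the same mean. -/
theorem tendsto_latticeMean (hdense : Dense (Prod.snd '' (Λ : Set (E × F))))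
    (hG : WienerAmalgam G) :
    Tendsto (fun r => latticeMean Λ r G 0) atTop
      (𝓝 ((ZLattice.covolume Λ volume)⁻¹ • ∫ u, G u)) := by
  obtain ⟨D, ρ, -, hD, hDρ⟩ := exists_fundamentalDomain_subset_ball volume Λ
  set M := 2 * ((ZLattice.covolume Λ volume)⁻¹ * ∫ u, localSup ρ G u)
  have hbound : ∀ᶠ r in atTop, ∀ q, ‖latticeMean Λ r G q‖ ≤ M :=
    (eventually_norm_inv_smul_latticeSum_le hD hDρ).mono fun r hr => hr _ Subset.rfl G hG
  have hmeas : ∀ r, StronglyMeasurable (latticeMean Λ r G) := fun r =>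
    (stronglyMeasurable_latticeSum isClosed_closedBall.measurableSet isBounded_closedBall
      hG).const_smul _
  have hDfin : IsFiniteMeasure (volume.restrict D) := isFiniteMeasure_restrict.2
    ((measure_mono hDρ).trans_lt measure_ball_lt_top).ne
  have hDvol : volume.real D = ZLattice.covolume Λ volume := by
    rw [measureReal_def, measure_fundamentalDomain hD,
      ENNReal.toReal_ofReal (ZLattice.covolume_pos Λ volume).le]
  have hdiff : Tendsto (fun r => ∫ q in D, (latticeMean Λ r G q - latticeMean Λ r G 0)) atTop
      (𝓝 0) := by
    rw [← integral_zero (E × F) β (μ := volume.restrict D)]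
    refine tendsto_integral_filter_of_dominated_convergence (fun _ => M + M)
      (.of_forall fun r => ((hmeas r).sub stronglyMeasurable_const).aestronglyMeasurable)
      (hbound.mono fun r hr => .of_forall fun q =>
        (norm_sub_le _ _).trans (add_le_add (hr q) (hr 0)))
      (integrable_const _) (.of_forall fun q => ?_)
    exact Metric.tendsto_nhds.2 fun ε hε => by
      simpa only [dist_zero_right] using eventually_norm_latticeMean_sub_le hdense hG q hε
  have hmean : ∀ᶠ r in atTop, ∫ q in D, (latticeMean Λ r G q - latticeMean Λ r G 0)
      = (∫ u, G u) - ZLattice.covolume Λ volume • latticeMean Λ r G 0 := by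
    filter_upwards [hbound, eventually_gt_atTop 0] with r hr hr0
    rw [integral_sub (.of_bound (hmeas r).aestronglyMeasurable M (.of_forall hr))
      (integrable_const _), setIntegral_const, hDvol, setIntegral_latticeMean hD hG hr0]
  have hcov := ZLattice.covolume_ne_zero Λ volume
  have := ((tendsto_const_nhds (x := ∫ u, G u)).sub (hdiff.congr' hmean)).const_smul
    (ZLattice.covolume Λ volume)⁻¹
  simpa only [sub_sub_cancel, inv_smul_smul₀ hcov, sub_zero] using this

end Equidistribution

section CutAndProjectCombs

variable {d m : ℕ} {Λ : Submodule ℤ (EuclideanSpace ℝ (Fin d) × EuclideanSpace ℝ (Fin m))}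
  {φ : EuclideanSpace ℝ (Fin m) → ℂ}

theorem directModule_eq_range : directModule Λ = range fun l : Λ => l.1.1 := by
  rw [directModule, image_eq_range]
  rfl

theorem denseComb_covolume_inv_mul_autocorr :
    denseComb Λ (fun v => (ZLattice.covolume Λ volume : ℂ)⁻¹ * autocorr φ v)
      = diracComb (directModule Λ) (autocorrCoeff Λ φ) :=
  congrArg (diracComb _) (funext fun _ => rfl)

theorem injective_fst_coe (hΛ : InjOn Prod.fst (SetLike.coe Λ)) :
    Function.Injective fun l : Λ => l.1.1 :=
  injOn_iff_injective.1 hΛ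

theorem starMap_fst (hΛ : InjOn Prod.fst (SetLike.coe Λ)) (l : Λ) : starMap Λ l.1.1 = l.1.2 := by
  have hl : ∃ a ∈ SetLike.coe Λ, a.1 = l.1.1 := ⟨l, l.2, rfl⟩
  rw [starMap, hΛ (Function.invFunOn_mem hl) l.2 (Function.invFunOn_eq hl)]

theorem indicator_preimage_fst_starMap (hΛ : InjOn Prod.fst (SetLike.coe Λ))
    (B : Set (EuclideanSpace ℝ (Fin d))) :
    ((fun l : Λ => l.1.1) ⁻¹' B).indicator ((fun x => φ (starMap Λ x)) ∘ fun l : Λ => l.1.1)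
      = fun l => cylinder B φ l.1 := by
  simp only [Function.comp_def, starMap_fst hΛ]
  rfl

variable [DiscreteTopology Λ] [IsZLattice ℝ Λ] (hΛ : InjOn Prod.fst (SetLike.coe Λ))
  (hφ : WienerAmalgam φ)

include hΛ hφ

theorem locallySummable_starMap :
    LocallySummable (directModule Λ) fun x => φ (starMap Λ x) := by
  rw [directModule_eq_range, locallySummable_range_iff (injective_fst_coe hΛ)]
  intro B hB
  rw [indicator_preimage_fst_starMap hΛ]
  simpa only [add_zero] using (summable_norm_cylinder (Λ := Λ) hB hφ 0).of_norm

theorem isAtomic_restrict_denseComb {B : Set (EuclideanSpace ℝ (Fin d))} (hB : MeasurableSet B)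
    (hB' : IsBounded B) :
    IsAtomic ((denseComb Λ φ).restrict B) (fun l : Λ => l.1.1) fun l => cylinder B φ l.1 := by
  have h := locallySummable_starMap hΛ hφ
  rw [directModule_eq_range] at h
  rw [← indicator_preimage_fst_starMap hΛ, denseComb, directModule_eq_range]
  exact isAtomic_restrict_diracComb_range (injective_fst_coe hΛ) h hB hB'

theorem hasSum_integral_denseComb {g : EuclideanSpace ℝ (Fin d) → ℂ} (hg : Continuous g)
    (hg' : HasCompactSupport g) :
    HasSum (fun l : Λ => g l.1.1 * φ l.1.2) ((denseComb Λ φ).integral g) := by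
  have h := locallySummable_starMap hΛ hφ
  rw [directModule_eq_range] at h
  simpa only [denseComb, directModule_eq_range, starMap_fst hΛ]
    using hasSum_integral_diracComb_range (injective_fst_coe hΛ) h hg hg'

theorem translationBounded_denseComb : (denseComb Λ φ).TranslationBounded := by
  intro K hK
  obtain ⟨R, hR⟩ := hK.isBounded.subset_closedBall 0
  obtain ⟨D, ρ, -, hD, hDρ⟩ := exists_fundamentalDomain_subset_ball volume Λ
  refine ⟨Real.toNNReal ((ZLattice.covolume Λ volume)⁻¹ *
    (volume.real (Metric.closedBall (0 : EuclideanSpace ℝ (Fin d)) (R + ρ)) *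
      ∫ u, localSup ρ φ u)), fun y => ?_⟩
  have hKy : IsCompact ((y + ·) '' K) := hK.image (continuous_const_add y)
  have hsub : Metric.thickening ρ ((y + ·) '' K) ⊆ Metric.closedBall y (R + ρ) := by
    refine (Metric.thickening_subset_of_subset ρ ?_).trans (thickening_closedBall_subset y)
    rintro _ ⟨x, hx, rfl⟩
    simpa using hR hx
  have hvol : volume.real (Metric.thickening ρ ((y + ·) '' K))
      ≤ volume.real (Metric.closedBall (0 : EuclideanSpace ℝ (Fin d)) (R + ρ)) := by
    rw [measureReal_def volume (Metric.closedBall 0 _),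
      ← Measure.addHaar_closedBall_center volume y]
    exact measureReal_mono hsub measure_closedBall_lt_top.ne
  have hsum := tsum_norm_cylinder_le hD hDρ hKy.isBounded hφ 0
  simp only [add_zero] at hsum
  refine (measure_mono (subset_univ _)).trans <| (isAtomic_restrict_denseComb hΛ hφ
    hKy.measurableSet hKy.isBounded).variation_univ_le.trans <|
      ENNReal.ofReal_le_ofReal (hsum.trans ?_)
  gcongr
  · exact inv_nonneg.2 (ZLattice.covolume_pos Λ volume).le
  · exact integral_nonneg fun _ => localSup_nonneg _ _ _

end CutAndProjectCombs

section PairMeans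

open Metric

variable {E F 𝕜 : Type*} [NormedAddCommGroup E] [NormedAddCommGroup F] [RCLike 𝕜]

theorem cylinder_mul_conj_cylinder_sub (A : Set E) (f : F → 𝕜) (x z : E × F) :
    cylinder A f x * starRingEnd 𝕜 (cylinder A f (x - z))
      = cylinder (A ∩ (· - z.1) ⁻¹' A) (fun u => f u * starRingEnd 𝕜 (f (u - z.2))) x := by
  by_cases h : x.1 ∈ A <;> by_cases h' : x.1 - z.1 ∈ A <;> simp [cylinder, h, h']

variable [NormedSpace ℝ E] [FiniteDimensional ℝ E]
  [MeasureSpace E] [BorelSpace E] [(volume : Measure E).IsAddHaarMeasure]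
  [NormedSpace ℝ F] [FiniteDimensional ℝ F]
  [MeasureSpace F] [BorelSpace F] [(volume : Measure F).IsAddHaarMeasure]
  {Λ : Submodule ℤ (E × F)} [DiscreteTopology Λ] [IsZLattice ℝ Λ] {D : Set (E × F)} {ρ : ℝ}
  {f : F → 𝕜}

/-- The weight of the difference vector `z` in the finite autocorrelation of radius `r`: the sum of
`f u * conj (f (u - z⋆))` over those pairs of lattice points above `B_r` whose difference is `z`,
divided by `vol B_r`. -/
def pairMean (Λ : Submodule ℤ (E × F)) (f : F → 𝕜) (r : ℝ) (z : E × F) : 𝕜 :=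
  (volume.real (closedBall (0 : E) r))⁻¹ •
    latticeSum Λ (closedBall 0 r ∩ (· - z.1) ⁻¹' closedBall 0 r)
      (fun u => f u * starRingEnd 𝕜 (f (u - z.2))) 0

theorem tendsto_pairMean (hdense : Dense (Prod.snd '' (Λ : Set (E × F)))) (hf : WienerAmalgam f)
    (z : E × F) : Tendsto (fun r => pairMean Λ f r z) atTop
      (𝓝 ((ZLattice.covolume Λ volume)⁻¹ • autocorr f z.2)) := by
  have hsub (r : ℝ) : symmDiff (closedBall 0 r ∩ (· - z.1) ⁻¹' closedBall 0 r) (closedBall 0 r)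
      ⊆ annulus E r ‖-z.1‖ := by
    refine subset_trans ?_ (symmDiff_preimage_add_subset_annulus (-z.1) r)
    rintro x (⟨⟨hx, -⟩, hx'⟩ | ⟨hx, hx'⟩)
    exacts [absurd hx hx', Or.inr ⟨hx, fun h => hx' ⟨hx, by simpa [sub_eq_add_neg] using h⟩⟩]
  have hG := hf.mul_conj_translate z.2
  have h := (tendsto_inv_smul_latticeSum_sub (Λ := Λ) hG (norm_nonneg _) hsub 0).add
    (tendsto_latticeMean hdense hG)
  rw [zero_add] at h
  refine h.congr fun r => ?_
  rw [latticeMean, ← smul_add, sub_add_cancel, pairMean]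

theorem integral_localSup_mul_conj_translate_le (hf : WienerAmalgam f) (ρ : ℝ) (v : F) :
    ∫ u, localSup ρ (fun u => f u * starRingEnd 𝕜 (f (u - v))) u ≤ autocorr (localSup ρ f) v := by
  have := FiniteDimensional.proper_real F
  refine integral_mono ((hf.mul_conj_translate v).integrable_localSup ρ)
    ((hf.localSup ρ).mul_conj_translate v).integrable fun u =>
    localSup_le (mul_nonneg (localSup_nonneg _ _ _) (localSup_nonneg _ _ _)) fun x hx => ?_
  rw [norm_mul, RCLike.norm_conj, add_sub_right_comm]
  exact mul_le_mul (norm_le_localSup hf.continuous hx u) (norm_le_localSup hf.continuous hx _)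
    (norm_nonneg _) (localSup_nonneg _ _ _)

theorem eventually_norm_pairMean_le (hD : IsAddFundamentalDomain Λ D volume) (hDρ : D ⊆ ball 0 ρ)
    (hf : WienerAmalgam f) : ∀ᶠ r in atTop, ∀ z,
      ‖pairMean Λ f r z‖ ≤ 2 * ((ZLattice.covolume Λ volume)⁻¹ * autocorr (localSup ρ f) z.2) := by
  filter_upwards [eventually_norm_inv_smul_latticeSum_le (β := 𝕜) hD hDρ] with r hr z
  refine (hr _ inter_subset_left _ (hf.mul_conj_translate z.2) 0).trans ?_
  have hc : 0 ≤ (ZLattice.covolume Λ volume)⁻¹ := inv_nonneg.2 (ZLattice.covolume_pos Λ volume).le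
  gcongr
  exact integral_localSup_mul_conj_translate_le hf ρ z.2

/-- Dominated convergence: since `autocorr (localSup ρ f)` is again in the amalgam space, its sum
over the lattice points above the support of `g` is finite. -/
theorem tendsto_tsum_mul_pairMean (hdense : Dense (Prod.snd '' (Λ : Set (E × F))))
    (hf : WienerAmalgam f) {g : E → 𝕜} (hg : Continuous g) (hg' : HasCompactSupport g) :
    Tendsto (fun r => ∑' z : Λ, g z.1.1 * pairMean Λ f r z) atTop
      (𝓝 (∑' z : Λ, g z.1.1 * ((ZLattice.covolume Λ volume)⁻¹ • autocorr f z.1.2))) := by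
  have := FiniteDimensional.proper_real F
  obtain ⟨M, hM⟩ := hg.bounded_above_of_compact_support hg'
  obtain ⟨D, ρ, -, hD, hDρ⟩ := exists_fundamentalDomain_subset_ball volume Λ
  set c := (ZLattice.covolume Λ volume)⁻¹
  set h := autocorr (localSup ρ f)
  have hsum : Summable fun z : Λ => M * (2 * (c * ‖cylinder (tsupport g) h z.1‖)) := by
    simpa only [add_zero] using (((summable_norm_cylinder (Λ := Λ) hg'.isBounded
      (hf.localSup ρ).autocorr 0).mul_left c).mul_left 2).mul_left M
  refine tendsto_tsum_of_dominated_convergence hsum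
    (fun z => (tendsto_pairMean hdense hf z.1).const_mul _) ?_
  filter_upwards [eventually_norm_pairMean_le hD hDρ hf] with r hr z
  by_cases hz : z.1.1 ∈ tsupport g
  · rw [norm_mul, cylinder, indicator_of_mem (mem_preimage.2 hz)]
    refine mul_le_mul (hM _) ((hr z).trans ?_) (norm_nonneg _) ((norm_nonneg _).trans (hM 0))
    have hc : 0 ≤ c := inv_nonneg.2 (ZLattice.covolume_pos Λ volume).le
    gcongr
    exact le_abs_self _
  · rw [image_eq_zero_of_notMem_tsupport hz, cylinder, indicator_of_notMem (by exact hz)]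
    simp

end PairMeans

section PositiveDefiniteness

open scoped ComplexOrder

variable {E : Type*} [NormedAddCommGroup E] {g : E → ℂ}

theorem continuous_tildeFun (hg : Continuous g) : Continuous (tildeFun g) :=
  Complex.continuous_conj.comp (hg.comp continuous_neg)

theorem hasCompactSupport_tildeFun (hg : HasCompactSupport g) : HasCompactSupport (tildeFun g) :=
  (hg.comp_homeomorph (Homeomorph.neg E)).comp_left (map_zero _)

variable [MeasureSpace E] [BorelSpace E] [(volume : Measure E).IsAddHaarMeasure]

theorem convolution_tildeFun_sub (g : E → ℂ) (x y : E) :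
    convolution g (tildeFun g) (ContinuousLinearMap.mul ℝ ℂ) volume (x - y)
      = ∫ t, g (t + x) * starRingEnd ℂ (g (t + y)) := by
  rw [convolution, ← integral_add_right_eq_self _ x]
  refine integral_congr_ae (Eventually.of_forall fun t => ?_)
  simp only [tildeFun, ContinuousLinearMap.mul_apply', neg_sub]
  congr 3
  abel

variable (hg : Continuous g) (hg' : HasCompactSupport g)

include hg hg'

theorem continuous_convolution_tildeFun [NormedSpace ℝ E] [FiniteDimensional ℝ E] :
    Continuous (convolution g (tildeFun g) (ContinuousLinearMap.mul ℝ ℂ) volume) :=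
  (hasCompactSupport_tildeFun hg').continuous_convolution_right _ hg.locallyIntegrable
    (continuous_tildeFun hg)

/-- The double sum is the integral of `|∑ i, w i * g (t + x i)|²` over `t`. -/
theorem sum_convolution_tildeFun_nonneg {ι : Type*} (s : Finset ι) (x : ι → E) (w : ι → ℂ) :
    0 ≤ ∑ p ∈ s ×ˢ s, convolution g (tildeFun g) (ContinuousLinearMap.mul ℝ ℂ) volume
      (x p.1 - x p.2) * (w p.1 * starRingEnd ℂ (w p.2)) := by
  have hint (p : ι × ι) : Integrable fun t =>
      g (t + x p.1) * starRingEnd ℂ (g (t + x p.2)) * (w p.1 * starRingEnd ℂ (w p.2)) :=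
    (Continuous.integrable_of_hasCompactSupport
      ((hg.comp (continuous_add_const _)).mul
        (Complex.continuous_conj.comp (hg.comp (continuous_add_const _))))
      (hg'.comp_homeomorph (Homeomorph.addRight (x p.1))).mul_right).mul_const _
  simp only [convolution_tildeFun_sub, ← integral_mul_const]
  rw [← integral_finsetSum _ fun p _ => hint p]
  refine integral_nonneg fun t => ?_
  calc (0 : ℂ) ≤ (∑ i ∈ s, w i * g (t + x i)) * starRingEnd ℂ (∑ i ∈ s, w i * g (t + x i)) :=
        mul_star_self_nonneg _
    _ = _ := by
        rw [map_sum, Finset.sum_mul_sum, ← Finset.sum_product']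
        refine Finset.sum_congr rfl fun p _ => ?_
        rw [map_mul]
        ring

theorem IsAtomic.integral_convolution_tildeFun_nonneg [NormedSpace ℝ E] [FiniteDimensional ℝ E]
    {ν : ComplexMeasure E} {ι : Type*} {x : ι → E} {w : ι → ℂ} {a : ℂ} (ha : 0 ≤ a)
    (h : IsAtomic ν (fun p : ι × ι => x p.1 - x p.2)
      fun p => a * (w p.1 * starRingEnd ℂ (w p.2))) :
    0 ≤ ∫ᵛ y, convolution g (tildeFun g) (ContinuousLinearMap.mul ℝ ℂ) volume y
      ∂[ContinuousLinearMap.mul ℝ ℂ; ν] := by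
  have hcont := continuous_convolution_tildeFun hg hg'
  obtain ⟨C, hC⟩ := hcont.bounded_above_of_compact_support
    (hg'.convolution _ (hasCompactSupport_tildeFun hg'))
  have hsum := h.hasSum_integral hcont.stronglyMeasurable hC
  rw [HasSum, SummationFilter.unconditional_filter] at hsum
  have hdiag : Tendsto (fun s : Finset ι => (s, s)) atTop atTop := by
    rw [← prod_atTop_atTop_eq]
    exact tendsto_id.prodMk tendsto_id
  refine ge_of_tendsto' (hsum.comp (tendsto_finsetProd_atTop.comp hdiag)) fun s => ?_
  simp only [Function.comp_apply, mul_left_comm _ a, ← Finset.mul_sum]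
  exact mul_nonneg ha (sum_convolution_tildeFun_nonneg hg hg' s x w)

end PositiveDefiniteness

section FiniteAutocorrelation

open Metric

variable {d m : ℕ} {Λ : Submodule ℤ (EuclideanSpace ℝ (Fin d) × EuclideanSpace ℝ (Fin m))}
  [DiscreteTopology Λ] [IsZLattice ℝ Λ] {f : EuclideanSpace ℝ (Fin m) → ℂ}
  (hΛ : InjOn Prod.fst (SetLike.coe Λ)) (hf : WienerAmalgam f)

include hΛ hf

theorem isAtomic_finiteAutocorrelation (r : ℝ) :
    IsAtomic (finiteAutocorrelation (denseComb Λ f) r) (fun p : Λ × Λ => p.1.1.1 - p.2.1.1)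
      (fun p => (((volume.real (closedBall (0 : EuclideanSpace ℝ (Fin d)) r))⁻¹ : ℝ) : ℂ) *
        (cylinder (closedBall 0 r) f p.1.1 *
          starRingEnd ℂ (cylinder (closedBall 0 r) f p.2.1))) := by
  have h := isAtomic_restrict_denseComb hΛ hf
    (isClosed_closedBall (x := 0) (ε := r)).measurableSet isBounded_closedBall
  have htilde : IsAtomic (tildeMeasure ((denseComb Λ f).restrict (closedBall 0 r)))
      (fun l : Λ => -l.1.1) fun l => starRingEnd ℂ (cylinder (closedBall 0 r) f l.1) :=
    (h.map measurable_neg).mapRange Complex.continuous_conj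
  simpa only [sub_eq_add_neg] using! ((h.prod htilde).map
    (measurable_fst.add measurable_snd)).smul _

theorem integral_finiteAutocorrelation (r : ℝ) {g : EuclideanSpace ℝ (Fin d) → ℂ}
    (hg : Continuous g) (hg' : HasCompactSupport g) :
    ∫ᵛ x, g x ∂[ContinuousLinearMap.mul ℝ ℂ; finiteAutocorrelation (denseComb Λ f) r]
      = ∑' z : Λ, g z.1.1 * pairMean Λ f r z := by
  obtain ⟨C, hC⟩ := hg.bounded_above_of_compact_support hg'
  have h := (isAtomic_finiteAutocorrelation hΛ hf r).hasSum_integral hg.stronglyMeasurable hC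
  let e : Λ × Λ ≃ Λ × Λ :=
    (Equiv.prodComm Λ Λ).trans (Equiv.prodShear (Equiv.refl Λ) Equiv.subLeft)
  rw [← e.hasSum_iff] at h
  refine (h.prod_fiberwise fun z => ?_).tsum_eq.symm
  have hsum := (summable_norm_cylinder (Λ := Λ)
    (A := closedBall 0 r ∩ (· - z.1.1) ⁻¹' closedBall 0 r)
    (isBounded_closedBall.subset inter_subset_left) (hf.mul_conj_translate z.1.2) 0).of_norm.hasSum
  convert! (hsum.const_smul (volume.real (closedBall (0 : EuclideanSpace ℝ (Fin d)) r))⁻¹).mul_left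
    (g z.1.1) using 2 with l
  rw [add_zero, ← cylinder_mul_conj_cylinder_sub]
  simp [e]

/-- Regrouping the pairs of lattice points by their difference turns the finite autocorrelation into
a sum over the lattice, whose coefficients converge by equidistribution. -/
theorem isAutocorrelation_denseComb (hdense : Dense (Prod.snd '' SetLike.coe Λ)) :
    IsAutocorrelation (denseComb Λ f)
      (denseComb Λ fun v => (ZLattice.covolume Λ volume : ℂ)⁻¹ * autocorr f v) := by
  intro g hg hg'
  simp only [integral_finiteAutocorrelation hΛ hf _ hg hg']
  rw [← (hasSum_integral_denseComb hΛ (hf.autocorr.const_mul _) hg hg').tsum_eq]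
  simpa only [Complex.real_smul, Complex.ofReal_inv] using
    tendsto_tsum_mul_pairMean hdense hf hg hg'

open scoped ComplexOrder in
theorem positiveDefinite_of_isAutocorrelation_denseComb
    {γ : LocalComplexMeasure (EuclideanSpace ℝ (Fin d))}
    (hγ : IsAutocorrelation (denseComb Λ f) γ) : γ.PositiveDefinite := by
  intro g hg hg'
  have hnonneg := ge_of_tendsto' (hγ _ (continuous_convolution_tildeFun hg hg')
      (hg'.convolution _ (hasCompactSupport_tildeFun hg'))) fun r =>
    (isAtomic_finiteAutocorrelation hΛ hf r).integral_convolution_tildeFun_nonneg hg hg'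
      (x := fun l : Λ => l.1.1) (w := fun l : Λ => cylinder (closedBall 0 r) f l.1)
      (Complex.zero_le_real.2 (inv_nonneg.2 measureReal_nonneg))
  rw [Complex.nonneg_iff] at hnonneg
  exact ⟨hnonneg.1, hnonneg.2.symm⟩

end FiniteAutocorrelation

end DenseComb

end

theorem theorem3p4_general {d m : ℕ}
    (Λ : Submodule ℤ (EuclideanSpace ℝ (Fin d) × EuclideanSpace ℝ (Fin m)))
    [DiscreteTopology Λ] [IsZLattice ℝ Λ]
    (hinj : InjOn Prod.fst (Λ : Set (EuclideanSpace ℝ (Fin d) × EuclideanSpace ℝ (Fin m))))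
    (hdense : Dense (Prod.snd ''
      (Λ : Set (EuclideanSpace ℝ (Fin d) × EuclideanSpace ℝ (Fin m)))))
    (f : EuclideanSpace ℝ (Fin m) → ℂ) (hf : DenseComb.WienerAmalgam f) :
    DenseComb.LocallySummable (DenseComb.directModule Λ) (fun x => f (DenseComb.starMap Λ x)) ∧
    (∀ z ∈ DenseComb.directModule Λ,
      Integrable fun u => f u * starRingEnd ℂ (f (u - DenseComb.starMap Λ z))) ∧
    DenseComb.LocallySummable (DenseComb.directModule Λ) (DenseComb.autocorrCoeff Λ f) ∧
    ∃ γ : DenseComb.LocalComplexMeasure (EuclideanSpace ℝ (Fin d)),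
      γ = DenseComb.diracComb (DenseComb.directModule Λ) (DenseComb.autocorrCoeff Λ f) ∧
      DenseComb.IsAutocorrelation (DenseComb.denseComb Λ f) γ ∧
      (∀ γ' : DenseComb.LocalComplexMeasure (EuclideanSpace ℝ (Fin d)),
        DenseComb.IsAutocorrelation (DenseComb.denseComb Λ f) γ' → γ' = γ) ∧
      γ.TranslationBounded ∧ γ.PositiveDefinite ∧ γ.PurePoint := by
  have hη := hf.autocorr.const_mul (ZLattice.covolume Λ volume : ℂ)⁻¹
  have hsum := DenseComb.locallySummable_starMap hinj hη
  have hlim := DenseComb.isAutocorrelation_denseComb hinj hf hdense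
  exact ⟨DenseComb.locallySummable_starMap hinj hf,
    fun z _ => (hf.mul_conj_translate (DenseComb.starMap Λ z)).integrable, hsum,
    _, DenseComb.denseComb_covolume_inv_mul_autocorr, hlim,
    fun γ' hγ' => DenseComb.LocalComplexMeasure.ext_of_integral fun g hg hg' =>
      tendsto_nhds_unique (hγ' g hg hg') (hlim g hg hg'),
    DenseComb.translationBounded_denseComb hinj hη,
    DenseComb.positiveDefinite_of_isAutocorrelation_denseComb hinj hf hlim,
    DenseComb.purePoint_diracComb hsum⟩

theorem theorem3p4 {d m : ℕ}
    (Λ : Submodule ℤ (EuclideanSpace ℝ (Fin d) × EuclideanSpace ℝ (Fin m)))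
    [DiscreteTopology Λ] [IsZLattice ℝ Λ] (hΛ : DenseComb.IsDenseCutAndProject Λ)
    (f : EuclideanSpace ℝ (Fin m) → ℂ) (hf : Continuous f)
    (C α : ℝ) (hC : 0 < C) (hα : 0 < α)
    (hdecay : ∀ x, ‖x‖ ^ ((m : ℝ) + 1 + α) * ‖f x‖ ≤ C) :
    -- the comb `ω` and the measure `∑ η(z) δ_z` are well defined
    DenseComb.LocallySummable (DenseComb.directModule Λ) (fun x => f (DenseComb.starMap Λ x)) ∧
    (∀ z ∈ DenseComb.directModule Λ,
      Integrable fun u => f u * starRingEnd ℂ (f (u - DenseComb.starMap Λ z))) ∧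
    DenseComb.LocallySummable (DenseComb.directModule Λ) (DenseComb.autocorrCoeff Λ f) ∧
    ∃ γ : DenseComb.LocalComplexMeasure (EuclideanSpace ℝ (Fin d)),
      γ = DenseComb.diracComb (DenseComb.directModule Λ) (DenseComb.autocorrCoeff Λ f) ∧
      DenseComb.IsAutocorrelation (DenseComb.denseComb Λ f) γ ∧
      (∀ γ' : DenseComb.LocalComplexMeasure (EuclideanSpace ℝ (Fin d)),
        DenseComb.IsAutocorrelation (DenseComb.denseComb Λ f) γ' → γ' = γ) ∧
      γ.TranslationBounded ∧ γ.PositiveDefinite ∧ γ.PurePoint := by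
  exact theorem3p4_general Λ hΛ.injOn_fst hΛ.dense_snd f <|
    .of_norm_rpow_mul_le hf (by rw [finrank_euclideanSpace_fin]; linarith) hdecay
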